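/- **Theorem.** Let $n\ge 2$ and let $\widetilde A_n$ be the group of affine permutations, i.e. bijections $\sigma:\mathbb Z\to\mathbb Z$ with $\sigma(q+kn)=\sigma(q)+kn$ for all $k,q\in\mathbb Z$ and $\sigma(1)+\cdots+\sigma(n)=n(n+1)/2$. It is generated by the $s_i$ ($i\in\mathbb Z/n\mathbb Z$), where $s_i$ exchanges $j$ and $j+1$ for every $j\equiv i \pmod n$; let $\ell$ be the length with respect to these generators. For every $\omega\in\widetilde A_n$, the set $\mathrm{Inv}_{\widetilde A}(\omega)$ is an initial section of the valued digraph $\widetilde{\mathcal A}$, and $$\widetilde F_\omega=\Gamma(\mathrm{Inv}_{\widetilde A}(\omega),\mathcal U^{col})$$ as formal power series in $x_1,x_2,\ldots$, where the objects are defined as follows. *Affine Stanley function.* A sequence $(i_1,\dots,i_k)$ in $\mathbb Z/n\mathbb Z$ is cyclically decreasing if its entries are distinct and $j+1$ occurs before $j$ whenever both occur; $v\in\widetilde A_n$ is cyclically decreasing if it has a reduced decomposition $v=s_{i_1}\cdots s_{i_k}$ with $(i_1,\dots,i_k)$ cyclically decreasing (in particular $v=\mathrm{Id}$). Then $$\widetilde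 F_\omega=\sum_{\omega=v_1v_2\cdots v_r}x_1^{\ell(v_1)}x_2^{\ell(v_2)}\cdots x_r^{\ell(v_r)},$$ the sum being over all factorizations of $\omega$ into cyclically decreasing $v_i\in\widetilde A_n$ with $\ell(\omega)=\sum_i\ell(v_i)$, where factorizations that differ only by trailing factors $\mathrm{Id}$ are identified. *Valued digraphs.* A valued digraph is a simple acyclic digraph $G=(V,E)$ with a map $\theta:V\to\mathbb N$ such that $\theta(x)\le|\{y:(x,y)\in E\}|$ for all $x\in V$. A vertex $x$ is erasable if $\theta(x)=0$ and $\theta(z)\ne0$ for all $z$ with $(z,x)\in E$. Peeling an erasable vertex $x$ means deleting $x$ with its incident arcs and lowering $\theta(y)$ by $1$ for every $y$ with $(y,x)\in E$; a peeling sequence is obtained by peeling successively erasable vertices until none is left (possibly forever). An initial section is the set $\{x_1,\dots,x_k\}$, $k\ge0$, of the first $k$ terms of some peeling sequence $[x_1,x_2,\dots]$. Given an initial section $A$ and a family $\mathcal U=(\mathcal U_z)_{z\in V}$ of subsets of $V$, let $\mathrm{SSF}(A,\mathcal U)$ be the set of functions $f:A\to\{1,2,\dots\}$ for which there is a peeling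 sequence with first $|A|$ terms $z_1,\dots,z_{|A|}$ such that $A=\{z_1,\dots,z_{|A|}\}$ and, for all $i<j\le|A|$, $f(z_i)\le f(z_j)$, with $f(z_i)<f(z_j)$ if $z_j\in\mathcal U_{z_i}$. Then $$\Gamma(A,\mathcal U)=\sum_{f\in\mathrm{SSF}(A,\mathcal U)}\ \prod_{z\in A}x_{f(z)}.$$ *The cylindrical valued digraph $\widetilde{\mathcal A}$.* Its vertex set is $\lambda_n^{cyl}=\{(a,b)\in\mathbb Z^2: 1\le a\le n,\ a<b,\ b\not\equiv a \pmod n\}$. There is an arc from $(a,b)$ to every other element of the cylindrical hook $$H^{cyl}(a,b)=\{(a,k)\in\lambda_n^{cyl}: a<k<b\}\ \cup\ \bigcup_{r\ge0}\{(k,q)\in\lambda_n^{cyl}: q+rn=b,\ a<k+rn<b\},$$ and $\theta(a,b)=|\{(a,k)\in\lambda_n^{cyl}: a<k<b\}|$. The columns are $\mathcal U^{col}_{(a,b)}=\{(a,k)\in\lambda_n^{cyl}: a<k\}$, and $\mathrm{Inv}_{\widetilde A}(\omega)=\{(a,b)\in\lambda_n^{cyl}:\omega^{-1}(a)>\omega^{-1}(b)\}$.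 -/

import Mathlib

open Finset

noncomputable section

/-! ### Valued digraphs and the peeling process -/

/-- A simple acyclic digraph whose vertices form a subset `verts` of an ambient type `V`, together
with an out-degree compatible valuation `val`. Only arcs between elements of `verts` and only the
values of `val` on `verts` are meaningful. -/
structure ValuedDigraph (V : Type*) where
  verts : Set V
  graph : Digraph V
  val : V → ℕ
  mem_of_adj : ∀ x y, graph.Adj x y → x ∈ verts ∧ y ∈ verts
  acyclic : ∀ x, ¬ Relation.TransGen graph.Adj x x
  val_le : ∀ x ∈ verts, (val x : ℕ∞) ≤ {y | graph.Adj x y}.encard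

namespace ValuedDigraph

variable {V : Type*}

/-- A vertex is erasable if its value is `0` and all its in-neighbours have nonzero value. -/
def Erasable (𝒢 : ValuedDigraph V) (x : V) : Prop :=
  x ∈ 𝒢.verts ∧ 𝒢.val x = 0 ∧ ∀ z, 𝒢.graph.Adj z x → 𝒢.val z ≠ 0

open Classical in
/-- Removing the vertex `x` and the arcs at `x`, and decreasing by one the value of each
in-neighbour of `x`. (If `x` is erasable, these values are positive.) -/
def erase (𝒢 : ValuedDigraph V) (x : V) : ValuedDigraph V where
  verts := 𝒢.verts \ {x}
  graph := ⟨fun y z => 𝒢.graph.Adj y z ∧ y ≠ x ∧ z ≠ x⟩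
  val := fun y => if 𝒢.graph.Adj y x then 𝒢.val y - 1 else 𝒢.val y
  mem_of_adj := fun y z h =>
    ⟨⟨(𝒢.mem_of_adj y z h.1).1, h.2.1⟩, ⟨(𝒢.mem_of_adj y z h.1).2, h.2.2⟩⟩
  acyclic := fun y h => 𝒢.acyclic y (Relation.TransGen.mono (p := 𝒢.graph.Adj) (fun _ _ h' => h'.1) y y h)
  val_le := by
    rintro y ⟨hy, hyx⟩
    have hyx' : y ≠ x := hyx
    have hset : {z | 𝒢.graph.Adj y z ∧ y ≠ x ∧ z ≠ x} = {z | 𝒢.graph.Adj y z} \ {x} := by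
      ext z
      simp [hyx']
    show ((if 𝒢.graph.Adj y x then 𝒢.val y - 1 else 𝒢.val y : ℕ) : ℕ∞) ≤
      {z | 𝒢.graph.Adj y z ∧ y ≠ x ∧ z ≠ x}.encard
    rw [hset]
    have hle := 𝒢.val_le y hy
    split_ifs with h
    · rw [← Set.encard_sdiff_singleton_add_one (show x ∈ {z | 𝒢.graph.Adj y z} from h)] at hle
      have : ((𝒢.val y - 1 : ℕ) : ℕ∞) = (𝒢.val y : ℕ∞) - 1 := by simp
      rw [this]
      exact tsub_le_iff_right.mpr hle
    · rw [Set.sdiff_singleton_eq_self (show x ∉ {z | 𝒢.graph.Adj y z} from h)]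
      exact hle

/-- `𝒢.IsPeeling L`: the finite list `L` can be obtained by successively choosing and removing
erasable vertices, starting from `𝒢`. Since any finite run of the peeling process can be continued
until it stops (or forever), these lists are exactly the finite initial segments of the
(maximal, possibly infinite) peeling sequences of `𝒢`. -/
def IsPeeling : ValuedDigraph V → List V → Prop
  | _, [] => True
  | 𝒢, x :: L => 𝒢.Erasable x ∧ IsPeeling (𝒢.erase x) L

/-- The initial segments of peeling sequences of `𝒢` whose set of entries is `A`. -/
def PSof (𝒢 : ValuedDigraph V) (A : Set V) : Set (List V) :=
  {L | 𝒢.IsPeeling L ∧ {x | x ∈ L} = A}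

/-- The set of initial sections of peeling sequences of `𝒢`. -/
def IS (𝒢 : ValuedDigraph V) : Set (Set V) :=
  {A | (𝒢.PSof A).Nonempty}

/-- The `(A, 𝒰)`-semi-standard functions: those `f : A → {1, 2, …}` for which there is a peeling
sequence `L` of `A` along which `f` is weakly increasing, and such that `f z < f w` whenever `w`
occurs after `z` in `L` and `w ∈ 𝒰 z`. -/
def SSF (𝒢 : ValuedDigraph V) (A : Set V) (𝒰 : V → Set V) : Set (A → ℕ+) :=
  {f | ∃ L : List A, L.map Subtype.val ∈ 𝒢.PSof A ∧
    L.Pairwise (fun z w => f z ≤ f w ∧ ((w : V) ∈ 𝒰 z → f z < f w))}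

/-- The semi-standard functions `f` with `∏_{z ∈ A} x_{f z} = x^m`; the exponent of `x_i` in this
product is the number of `z ∈ A` with `f z = i`. -/
def SSFOfContent (𝒢 : ValuedDigraph V) (A : Set V) (𝒰 : V → Set V) (m : ℕ+ →₀ ℕ) :
    Set (A → ℕ+) :=
  {f | f ∈ 𝒢.SSF A 𝒰 ∧ ∀ i, Nat.card {z // f z = i} = m i}

theorem finite_SSFOfContent (𝒢 : ValuedDigraph V) (A : Set V) (𝒰 : V → Set V) (m : ℕ+ →₀ ℕ) :
    (𝒢.SSFOfContent A 𝒰 m).Finite := by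
  by_cases hA : A.Finite
  · have : Finite A := hA
    refine (Set.Finite.pi' (t := fun _ : A => (m.support : Set ℕ+))
      fun _ => m.support.finite_toSet).subset ?_
    rintro f ⟨-, hf⟩ z
    have h : 0 < Nat.card {w // f w = f z} := Nat.card_pos_iff.mpr ⟨⟨⟨z, rfl⟩⟩, inferInstance⟩
    rw [hf] at h
    simpa using h.ne'
  · refine Set.Finite.subset Set.finite_empty ?_
    rintro f ⟨⟨L, ⟨-, hL⟩, -⟩, -⟩
    exact hA (hL ▸ List.finite_toSet _)

/-- The formal power series `Γ(A, 𝒰) = ∑_{f ∈ SSF(A, 𝒰)} ∏_{z ∈ A} x_{f z}` in the variables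
`x_1, x_2, …`: its coefficient at `x^m` is the (finite) number of semi-standard functions whose
monomial is `x^m`. -/
def Gam (𝒢 : ValuedDigraph V) (A : Set V) (𝒰 : V → Set V) : MvPowerSeries ℕ+ ℤ :=
  fun m => ((𝒢.SSFOfContent A 𝒰 m).ncard : ℤ)

end ValuedDigraph

/-! ### Affine permutations -/

/-- `σ (q + k n) = σ q + k n` for all `k` and `q`. -/
def IsPeriodicPerm (n : ℕ) (σ : Equiv.Perm ℤ) : Prop :=
  ∀ k q : ℤ, σ (q + k * n) = σ q + k * n

theorem IsPeriodicPerm.inv {n : ℕ} {σ : Equiv.Perm ℤ} (h : IsPeriodicPerm n σ) :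
    IsPeriodicPerm n σ⁻¹ := by
  intro k q
  apply σ.injective
  rw [h]
  simp

theorem sum_Icc_periodic (n : ℕ) [n.AtLeastTwo] (g : ℤ → ℤ)
    (hg : ∀ k q : ℤ, g (q + k * n) = g q) :
    ∑ q ∈ Icc (1 : ℤ) n, g q = ∑ z : ZMod n, g (z.cast : ℤ) := by
  have hn : (0 : ℤ) < n := by exact_mod_cast NeZero.pos n
  refine Finset.sum_bij (fun q _ => (q : ZMod n)) (fun _ _ => Finset.mem_univ _) ?_ ?_ ?_
  · intro a ha b hb hab
    rw [Finset.mem_Icc] at ha hb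
    rw [ZMod.intCast_eq_intCast_iff_dvd_sub] at hab
    have := Int.eq_zero_of_abs_lt_dvd hab (by rw [abs_lt]; constructor <;> linarith)
    linarith
  · intro z _
    refine ⟨1 + ((z.cast : ℤ) - 1) % n, ?_, ?_⟩
    · rw [Finset.mem_Icc]
      have h1 := Int.emod_nonneg ((z.cast : ℤ) - 1) hn.ne'
      have h2 := Int.emod_lt_of_pos ((z.cast : ℤ) - 1) hn
      constructor <;> linarith
    · push_cast
      simp
  · intro q _
    rw [ZMod.coe_intCast]
    have := hg (q / n) (q % n)
    rw [← this, mul_comm, Int.emod_add_mul_ediv]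

theorem sum_Icc_comp_perm (n : ℕ) [n.AtLeastTwo] (g : ℤ → ℤ)
    (hg : ∀ k q : ℤ, g (q + k * n) = g q) (τ : Equiv.Perm ℤ) (hτ : IsPeriodicPerm n τ) :
    ∑ q ∈ Icc (1 : ℤ) n, g (τ q) = ∑ q ∈ Icc (1 : ℤ) n, g q := by
  rw [sum_Icc_periodic n (fun q => g (τ q)) (fun k q => by rw [hτ, hg]), sum_Icc_periodic n g hg]
  have hinj : Function.Injective (fun z : ZMod n => ((τ (z.cast : ℤ) : ℤ) : ZMod n)) := by
    intro x y hxy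
    have hxy' : ((τ (x.cast : ℤ) : ℤ) : ZMod n) = ((τ (y.cast : ℤ) : ℤ) : ZMod n) := hxy
    rw [ZMod.intCast_eq_intCast_iff_dvd_sub] at hxy'
    obtain ⟨k, hk⟩ := hxy'
    have h1 : τ (y.cast : ℤ) = τ ((x.cast : ℤ) + k * n) := by rw [hτ]; linarith
    have h2 := congrArg (Int.cast : ℤ → ZMod n) (τ.injective h1)
    push_cast at h2
    simpa using h2.symm
  have hbij := Finite.injective_iff_bijective.mp hinj
  rw [← hbij.sum_comp (fun z : ZMod n => g (z.cast : ℤ))]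
  refine Finset.sum_congr rfl fun z _ => ?_
  rw [ZMod.coe_intCast]
  have := hg (τ (z.cast : ℤ) / n) (τ (z.cast : ℤ) % n)
  rw [← this, mul_comm, Int.emod_add_mul_ediv]

theorem sum_Icc_id (n : ℕ) : ∑ q ∈ Icc (1 : ℤ) n, q = (n : ℤ) * (n + 1) / 2 := by
  have h : 2 * ∑ q ∈ Icc (1 : ℤ) n, q = (n : ℤ) * (n + 1) := by
    induction n with
    | zero => simp
    | succ k ih =>
      have : Icc (1 : ℤ) ((k + 1 : ℕ) : ℤ) = insert ((k : ℤ) + 1) (Icc (1 : ℤ) k) := by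
        ext x
        simp only [Finset.mem_Icc, Finset.mem_insert]
        push_cast
        omega
      rw [this, Finset.sum_insert (by simp), mul_add, ih]
      push_cast
      ring
  omega

theorem sum_eq_iff (n : ℕ) (σ : Equiv.Perm ℤ) :
    ∑ q ∈ Icc (1 : ℤ) n, σ q = (n : ℤ) * (n + 1) / 2 ↔
      ∑ q ∈ Icc (1 : ℤ) n, (σ q - q) = 0 := by
  rw [Finset.sum_sub_distrib, sum_Icc_id, sub_eq_zero]

/-- The group `Ã_n` of affine permutations of period `n`. -/
def affinePerm (n : ℕ) [n.AtLeastTwo] : Subgroup (Equiv.Perm ℤ) where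
  carrier := {σ | IsPeriodicPerm n σ ∧ ∑ q ∈ Icc (1 : ℤ) n, σ q = (n : ℤ) * (n + 1) / 2}
  one_mem' := ⟨fun _ _ => rfl, sum_Icc_id n⟩
  mul_mem' := by
    rintro σ τ ⟨hσ, hσ'⟩ ⟨hτ, hτ'⟩
    refine ⟨fun k q => by simp only [Equiv.Perm.mul_apply]; rw [hτ, hσ], ?_⟩
    rw [sum_eq_iff] at hσ' hτ' ⊢
    have h := sum_Icc_comp_perm n (fun q => σ q - q) (fun k q => by rw [hσ]; ring) τ hτ
    rw [hσ'] at h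
    calc ∑ q ∈ Icc (1 : ℤ) n, ((σ * τ) q - q)
        = ∑ q ∈ Icc (1 : ℤ) n, ((σ (τ q) - τ q) + (τ q - q)) :=
          Finset.sum_congr rfl fun q _ => by rw [Equiv.Perm.mul_apply]; ring
      _ = 0 := by rw [Finset.sum_add_distrib, h, hτ', add_zero]
  inv_mem' := by
    rintro σ ⟨hσ, hσ'⟩
    refine ⟨hσ.inv, ?_⟩
    rw [sum_eq_iff] at hσ' ⊢
    have h := sum_Icc_comp_perm n (fun q => σ q - q) (fun k q => by rw [hσ]; ring) σ⁻¹ hσ.inv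
    rw [hσ'] at h
    rw [← neg_eq_zero, ← Finset.sum_neg_distrib, ← h]
    refine Finset.sum_congr rfl fun q _ => ?_
    have hq : σ (σ⁻¹ q) = q := by simp
    rw [hq, neg_sub]

/-- The map on `ℤ` exchanging `j` and `j + 1` for every `j` in the residue class `i`. -/
def simpleFun (n : ℕ) (i : ZMod n) (q : ℤ) : ℤ :=
  if (q : ZMod n) = i then q + 1 else if (q : ZMod n) = i + 1 then q - 1 else q

theorem simpleFun_involutive (n : ℕ) [n.AtLeastTwo] (i : ZMod n) :
    Function.Involutive (simpleFun n i) := by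
  have : Fact (1 < n) := ⟨Nat.AtLeastTwo.prop⟩
  intro q
  unfold simpleFun
  by_cases h1 : (q : ZMod n) = i
  · simp [h1]
  · by_cases h2 : (q : ZMod n) = i + 1
    · simp [h2]
    · simp [h1, h2]

/-- The simple reflection `s_i`, `i ∈ ℤ/nℤ`, as an element of `Ã_n`. -/
def simpleRefl (n : ℕ) [n.AtLeastTwo] (i : ZMod n) : affinePerm n :=
  ⟨(simpleFun_involutive n i).toPerm, by
    have : Fact (1 < n) := ⟨Nat.AtLeastTwo.prop⟩
    have hper : ∀ k q : ℤ, simpleFun n i (q + k * n) = simpleFun n i q + k * n := by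
      intro k q
      unfold simpleFun
      push_cast
      simp only [CharP.cast_eq_zero, mul_zero, add_zero]
      split_ifs <;> ring
    refine ⟨hper, ?_⟩
    rw [sum_eq_iff]
    show ∑ q ∈ Icc (1 : ℤ) n, (simpleFun n i q - q) = 0
    rw [sum_Icc_periodic n (fun q => simpleFun n i q - q) (fun k q => by rw [hper]; ring)]
    have h : ∀ z : ZMod n, simpleFun n i (z.cast : ℤ) - (z.cast : ℤ) =
        (if z = i then 1 else 0) - (if z = i + 1 then 1 else 0) := by
      intro z
      unfold simpleFun
      have hz : (((z.cast : ℤ)) : ZMod n) = z := by simp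
      rw [hz]
      by_cases h1 : z = i
      · simp [h1]
      · by_cases h2 : z = i + 1
        · simp [h2]
        · simp [h1, h2]
    simp only [h, Finset.sum_sub_distrib, Finset.sum_ite_eq', Finset.mem_univ, if_true, sub_self]⟩

section

variable {n : ℕ} [n.AtLeastTwo]

/-- The product `s_{i_1} ⋯ s_{i_k}`. -/
def wordProd (l : List (ZMod n)) : affinePerm n :=
  (l.map (simpleRefl n)).prod

/-- The Coxeter length: the least length of a word in the simple reflections (which generate
`Ã_n`) with product `ω`. -/
def affineLength (ω : affinePerm n) : ℕ :=
  sInf {k | ∃ l : List (ZMod n), l.length = k ∧ wordProd l = ω}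

/-- A reduced decomposition of `ω`. -/
def IsReducedWord (l : List (ZMod n)) (ω : affinePerm n) : Prop :=
  wordProd l = ω ∧ l.length = affineLength ω

/-! ### The affine Stanley symmetric function -/

/-- A sequence in `ℤ/nℤ` without repetition, in which `j + 1` comes before `j` whenever both
occur. -/
def IsCycDecWord (l : List (ZMod n)) : Prop :=
  l.Nodup ∧ ∀ p q : Fin l.length, l.get q = l.get p + 1 → q < p

/-- `v` has a cyclically decreasing reduced decomposition. -/
def IsCycDec (v : affinePerm n) : Prop :=
  ∃ l : List (ZMod n), IsCycDecWord l ∧ IsReducedWord l v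

/-- Cyclically decreasing factorizations `ω = v_1 v_2 ⋯ v_r`, with `ℓ(ω) = ∑ ℓ(v_i)`. As usual,
factorizations which differ only by trailing identity factors are identified: a factorization is a
sequence `(v_i)_{i ≥ 1}` with `v_i = 1` for `i > r`. -/
def IsCycDecFactorization (ω : affinePerm n) (v : ℕ+ → affinePerm n) : Prop :=
  (∀ i, IsCycDec (v i)) ∧ ∃ r : ℕ, (∀ i : ℕ+, r < (i : ℕ) → v i = 1) ∧
    ω = ((List.range r).map fun k => v k.succPNat).prod ∧
    affineLength ω = ∑ k ∈ Finset.range r, affineLength (v k.succPNat)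

/-- The factorizations of `ω` with monomial `x_1^{ℓ(v_1)} x_2^{ℓ(v_2)} ⋯ = x^m`. -/
def cycDecFactorizations (ω : affinePerm n) (m : ℕ+ →₀ ℕ) : Set (ℕ+ → affinePerm n) :=
  {v | IsCycDecFactorization ω v ∧ ∀ i, affineLength (v i) = m i}

theorem finite_isCycDec : {v : affinePerm n | IsCycDec v}.Finite := by
  have h : (Set.range fun l : {l : List (ZMod n) // l.Nodup} => wordProd l.1).Finite :=
    Set.finite_range _
  refine h.subset ?_
  rintro v ⟨l, hl, hv⟩
  exact ⟨⟨l, hl.1⟩, hv.1⟩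

theorem finite_cycDecFactorizations (ω : affinePerm n) (m : ℕ+ →₀ ℕ) :
    (cycDecFactorizations ω m).Finite := by
  classical
  have hfin : {v : m.support → affinePerm n | ∀ i, v i ∈ {v : affinePerm n | IsCycDec v}}.Finite :=
    Set.Finite.pi' fun _ => finite_isCycDec
  have hone : ∀ v ∈ cycDecFactorizations ω m, ∀ i, i ∉ m.support → v i = 1 := by
    rintro v ⟨⟨hv, -⟩, hm⟩ i hi
    obtain ⟨l, -, hl, hlen⟩ := hv i
    rw [hm, Finsupp.notMem_support_iff.mp hi, List.length_eq_zero_iff] at hlen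
    rw [← hl, hlen]
    rfl
  refine Set.Finite.of_finite_image
    (f := fun (v : ℕ+ → affinePerm n) (i : m.support) => v i) (hfin.subset ?_) ?_
  · rintro _ ⟨v, hv, rfl⟩ i
    exact hv.1.1 i
  · intro v hv w hw hvw
    funext i
    by_cases hi : i ∈ m.support
    · exact congrFun hvw ⟨i, hi⟩
    · rw [hone v hv i hi, hone w hw i hi]

/-- The affine Stanley symmetric function `F̃_ω = ∑ x_1^{ℓ(v_1)} x_2^{ℓ(v_2)} ⋯`, summed over the
cyclically decreasing factorizations of `ω`: its coefficient at `x^m` is the (finite) number of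
factorizations with monomial `x^m`. -/
def affineStanley (ω : affinePerm n) : MvPowerSeries ℕ+ ℤ :=
  fun m => ((cycDecFactorizations ω m).ncard : ℤ)

end

/-! ### The cylindrical valued digraph -/

/-- The boxes `(a, b)` of the cylindrical diagram: `1 ≤ a ≤ n`, `a < b`, `b ≢ a (mod n)`. -/
def CylDiagram (n : ℕ) : Type :=
  {c : ℤ × ℤ // 1 ≤ c.1 ∧ c.1 ≤ n ∧ c.1 < c.2 ∧ ¬ c.2 ≡ c.1 [ZMOD n]}

/-- The cylindrical hook of `(a, b)`. The first part is `{(a, k) | a < k < b}`. The second part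
is `{(k, b) | a < k < b}`, where `(k, b)` stands for the box `(k - r n, b - r n)` with
`1 ≤ k - r n ≤ n`: a pair is identified with its translates by multiples of `(n, n)`. -/
def cylHook {n : ℕ} (c : CylDiagram n) : Set (CylDiagram n) :=
  {d | d.1.1 = c.1.1 ∧ c.1.1 < d.1.2 ∧ d.1.2 < c.1.2} ∪
    {d | ∃ r : ℕ, d.1.2 + r * n = c.1.2 ∧ c.1.1 < d.1.1 + r * n ∧ d.1.1 + r * n < c.1.2}

theorem cylHook_lt {n : ℕ} {c d : CylDiagram n} (h : d ∈ cylHook c) :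
    d.1.2 - d.1.1 < c.1.2 - c.1.1 := by
  rcases h with ⟨h1, h2, h3⟩ | ⟨r, h1, h2, h3⟩ <;> linarith

theorem cylCol_subset {n : ℕ} (c : CylDiagram n) :
    {d : CylDiagram n | d.1.1 = c.1.1 ∧ c.1.1 < d.1.2 ∧ d.1.2 < c.1.2} ⊆
      {d | c ≠ d ∧ d ∈ cylHook c} := by
  rintro d ⟨h1, h2, h3⟩
  refine ⟨?_, Or.inl ⟨h1, h2, h3⟩⟩
  rintro rfl
  exact lt_irrefl _ h3

theorem cylCol_finite {n : ℕ} (c : CylDiagram n) :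
    {d : CylDiagram n | d.1.1 = c.1.1 ∧ c.1.1 < d.1.2 ∧ d.1.2 < c.1.2}.Finite := by
  refine Set.Finite.of_finite_image (f := fun d : CylDiagram n => d.1.2)
    ((Set.finite_Icc c.1.1 c.1.2).subset ?_) ?_
  · rintro _ ⟨d, hd, rfl⟩
    exact ⟨hd.2.1.le, hd.2.2.le⟩
  · intro d hd e he hde
    exact Subtype.ext (Prod.ext (hd.1.trans he.1.symm) hde)

/-- The cylindrical valued digraph: there is an arc from `c` to every other box of its cylindrical
hook, and the value of `(a, b)` is the number of boxes `(a, k)` with `a < k < b`. -/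
def cylDigraph (n : ℕ) : ValuedDigraph (CylDiagram n) where
  verts := Set.univ
  graph := ⟨fun c d => c ≠ d ∧ d ∈ cylHook c⟩
  val := fun c =>
    {d : CylDiagram n | d.1.1 = c.1.1 ∧ c.1.1 < d.1.2 ∧ d.1.2 < c.1.2}.ncard
  mem_of_adj := fun _ _ _ => ⟨trivial, trivial⟩
  acyclic := by
    intro x h
    have key : ∀ y, Relation.TransGen (fun c d : CylDiagram n => c ≠ d ∧ d ∈ cylHook c) x y →
        y.1.2 - y.1.1 < x.1.2 - x.1.1 := by
      intro y hy
      induction hy with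
      | single h => exact cylHook_lt h.2
      | tail _ h ih => exact (cylHook_lt h.2).trans ih
    exact lt_irrefl _ (key x h)
  val_le := by
    intro c _
    rw [(cylCol_finite c).cast_ncard_eq]
    exact Set.encard_le_encard (cylCol_subset c)

/-- The columns of the cylindrical diagram, as generalized columns. -/
def cylColumns (n : ℕ) (c : CylDiagram n) : Set (CylDiagram n) :=
  {d | d.1.1 = c.1.1}

/-- The inversion set `{(a, b) | 1 ≤ a ≤ n, a < b, ω⁻¹(a) > ω⁻¹(b)}`, as a subset of the
cylindrical diagram (pairs with `b ≡ a (mod n)` are never inversions). -/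
def affineInv {n : ℕ} [n.AtLeastTwo] (ω : affinePerm n) : Set (CylDiagram n) :=
  {c | (ω : Equiv.Perm ℤ)⁻¹ c.1.1 > (ω : Equiv.Perm ℤ)⁻¹ c.1.2}

end

/-!
For an affine permutation `u` the boxes of `affineInv u` are the pairs of values `a < b` (up to
translation by `(n, n)`) such that `b` stands to the left of `a` in `u`. Two facts about the weak
order are used throughout: `Inv (u v)` is the symmetric difference of `Inv u` and the image of
`Inv v` under the relabelling of the values by `u` (`exists_affineInv_mul_eq`), so that
`ℓ(u v) = ℓ(u) + ℓ(v)` if and only if `Inv u ⊆ Inv (u v)`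
(`affineLength_eq_ncard`, `ncard_affineInv_mul_eq_iff`); and `u` is determined by `Inv u`
(`affineInv_injective`).

*Peeling.* After the boxes of `Inv u` have been peeled, the value of a remaining box `(a, b)` is the
number of `k ≢ a` that lie between `a` and `b` both in value and in position (`ncard_lt_val_iff`).
It follows that, as long as one stays inside a given `Inv w`, the peelable boxes are exactly the
pairs of entries at adjacent positions (`peelable_of_ascent`, `Peelable.exists_ascent`). Hence
peeling lists of `Inv w` are maximal chains from `1` to `w` in the weak order: their prefixes are
inversion sets (`exists_affineInv_eq_of_isPeeling`), and every ascending chain below `w` is refined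
by one of them (`exists_isPeeling_append`). In particular `Inv w` is an initial section. The
restriction to boxes of a fixed `Inv w` matters: an arbitrary peeling sequence of the cylindrical
digraph may leave the family of inversion sets.

*Columns.* An element `v` is cyclically decreasing if and only if the boxes of `Inv v` lie in
pairwise distinct columns (`isCycDec_iff_colDistinct`): each value is passed by at most one larger
value. As `u` permutes the columns, for a length-additive product `u v` this can be read off from
the new boxes `Inv (u v) \ Inv u` (`colDistinct_sdiff_iff`).

*The correspondence.* A length-additive factorization `w = v_1 v_2 ⋯` is the chain of the sets
`Inv (v_1 ⋯ v_k)`. Mapping a box of `Inv w` to the least `k` for which it belongs to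
`Inv (v_1 ⋯ v_k)` gives a function whose fibres have `ℓ(v_k)` elements, and the factors are
cyclically decreasing exactly when no two boxes of a fibre share a column, which is the
semistandard condition (`exists_mem_SSF`, `exists_isCycDecFactorization`). This is a bijection that
preserves monomials.
-/

namespace AffinePerm

variable {n : ℕ}

/-! ### Boxes as translation classes of pairs -/

theorem modEq_iff_exists {a b : ℤ} : b ≡ a [ZMOD n] ↔ ∃ k : ℤ, b = a + k * n := by
  rw [Int.modEq_comm, Int.modEq_iff_dvd]
  constructor
  · rintro ⟨k, hk⟩
    exact ⟨k, by linarith⟩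
  · rintro ⟨k, hk⟩
    exact ⟨k, by linarith⟩

theorem intCast_eq_iff_exists {a b : ℤ} : (b : ZMod n) = a ↔ ∃ k : ℤ, b = a + k * n := by
  rw [ZMod.intCast_eq_intCast_iff, Int.modEq_comm, Int.modEq_iff_dvd]
  constructor
  · rintro ⟨k, hk⟩
    exact ⟨k, by linarith⟩
  · rintro ⟨k, hk⟩
    exact ⟨k, by linarith⟩

/-- The pair `(a, b)` is a translate of the box `c` by a multiple of `(n, n)`. Boxes are thus
identified with orbits of pairs `a < b`, `b ≢ a`. -/
def Rep (c : CylDiagram n) (a b : ℤ) : Prop :=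
  ∃ r : ℤ, a = c.1.1 + r * n ∧ b = c.1.2 + r * n

theorem rep_self (c : CylDiagram n) : Rep c c.1.1 c.1.2 := ⟨0, by simp, by simp⟩

theorem Rep.lt {c : CylDiagram n} {a b : ℤ} (h : Rep c a b) : a < b := by
  obtain ⟨r, rfl, rfl⟩ := h
  linarith [c.2.2.2.1]

theorem Rep.not_modEq {c : CylDiagram n} {a b : ℤ} (h : Rep c a b) : ¬ b ≡ a [ZMOD n] := by
  obtain ⟨r, rfl, rfl⟩ := h
  have := c.2.2.2.2
  rw [modEq_iff_exists] at this ⊢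
  rintro ⟨k, hk⟩
  exact this ⟨k, by linarith⟩

theorem Rep.shift {c : CylDiagram n} {a b : ℤ} (h : Rep c a b) (k : ℤ) :
    Rep c (a + k * n) (b + k * n) := by
  obtain ⟨r, rfl, rfl⟩ := h
  exact ⟨r + k, by ring, by ring⟩

theorem Rep.exists_shift {c : CylDiagram n} {a b a' b' : ℤ} (h : Rep c a b) (h' : Rep c a' b') :
    ∃ k : ℤ, a' = a + k * n ∧ b' = b + k * n := by
  obtain ⟨r, rfl, rfl⟩ := h
  obtain ⟨s, rfl, rfl⟩ := h'
  exact ⟨s - r, by ring, by ring⟩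

theorem simpleFun_self (p : ℤ) : simpleFun n p p = p + 1 := by
  simp [simpleFun]

theorem simpleFun_cases (p q : ℤ) :
    ((∃ k : ℤ, q = p + k * n) ∧ simpleFun n p q = q + 1) ∨
    ((∃ k : ℤ, q = p + 1 + k * n) ∧ simpleFun n p q = q - 1) ∨
    ((¬ ∃ k : ℤ, q = p + k * n) ∧ (¬ ∃ k : ℤ, q = p + 1 + k * n) ∧ simpleFun n p q = q) := by
  have h : ((p : ZMod n) + 1) = ((p + 1 : ℤ) : ZMod n) := by push_cast; rfl
  unfold simpleFun
  rw [h, ← intCast_eq_iff_exists, ← intCast_eq_iff_exists]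
  split_ifs with h1 h2
  · exact Or.inl ⟨h1, rfl⟩
  · exact Or.inr (Or.inl ⟨h2, rfl⟩)
  · exact Or.inr (Or.inr ⟨h1, h2, rfl⟩)

variable [n.AtLeastTwo]

/-! ### Affine permutations and inversions -/

/-- The position `u⁻¹ a` of the value `a` in the window notation of `u`. -/
def pos (u : affinePerm n) (a : ℤ) : ℤ := (u : Equiv.Perm ℤ)⁻¹ a

@[simp] theorem pos_apply (u : affinePerm n) (p : ℤ) : pos u (u.1 p) = p := by
  simp [pos]

@[simp] theorem apply_pos (u : affinePerm n) (a : ℤ) : u.1 (pos u a) = a := by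
  simp [pos]

@[simp] theorem pos_one (a : ℤ) : pos (1 : affinePerm n) a = a := by
  simp [pos]

theorem pos_mul (u v : affinePerm n) (a : ℤ) : pos (u * v) a = pos v (pos u a) := by
  simp [pos]

theorem apply_add_mul (u : affinePerm n) (a k : ℤ) : u.1 (a + k * n) = u.1 a + k * n :=
  u.2.1 k a

theorem pos_add_mul (u : affinePerm n) (a k : ℤ) : pos u (a + k * n) = pos u a + k * n :=
  u.2.1.inv k a

theorem pos_inj {u : affinePerm n} {a b : ℤ} : pos u a = pos u b ↔ a = b :=
  (u.1⁻¹).injective.eq_iff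

theorem n_pos : (0 : ℤ) < n := by exact_mod_cast NeZero.pos n

theorem two_le : (2 : ℤ) ≤ n := by exact_mod_cast (Nat.AtLeastTwo.prop : 2 ≤ n)

theorem apply_modEq_iff (u : affinePerm n) {a b : ℤ} :
    u.1 b ≡ u.1 a [ZMOD n] ↔ b ≡ a [ZMOD n] := by
  rw [modEq_iff_exists, modEq_iff_exists]
  refine exists_congr fun k => ?_
  rw [← apply_add_mul, u.1.injective.eq_iff]

theorem pos_modEq_iff (u : affinePerm n) {a b : ℤ} :
    pos u b ≡ pos u a [ZMOD n] ↔ b ≡ a [ZMOD n] := by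
  rw [← apply_modEq_iff u, apply_pos, apply_pos]

theorem not_succ_modEq (p : ℤ) : ¬ p + 1 ≡ p [ZMOD n] := by
  rw [modEq_iff_exists]
  rintro ⟨k, hk⟩
  have h1 : k * n = 1 := by linarith
  have h2 := two_le (n := n)
  have := Int.eq_one_or_neg_one_of_mul_eq_one' h1
  omega

theorem not_apply_succ_modEq (u : affinePerm n) (p : ℤ) : ¬ u.1 (p + 1) ≡ u.1 p [ZMOD n] := by
  rw [apply_modEq_iff]
  exact not_succ_modEq p

theorem exists_rep {a b : ℤ} (hab : a < b) (h : ¬ b ≡ a [ZMOD n]) :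
    ∃ c : CylDiagram n, Rep c a b := by
  have hn := n_pos (n := n)
  have h1 := Int.emod_nonneg (a - 1) hn.ne'
  have h2 := Int.emod_lt_of_pos (a - 1) hn
  have h3 := Int.emod_add_mul_ediv (a - 1) n
  refine ⟨⟨(a - (a - 1) / n * n, b - (a - 1) / n * n), ?_, ?_, ?_, ?_⟩, (a - 1) / n, ?_, ?_⟩
  · show 1 ≤ a - (a - 1) / n * n
    linarith
  · show a - (a - 1) / n * n ≤ n
    linarith
  · show a - (a - 1) / n * n < b - (a - 1) / n * n
    linarith
  · show ¬ b - (a - 1) / n * n ≡ a - (a - 1) / n * n [ZMOD n]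
    rw [modEq_iff_exists] at h ⊢
    rintro ⟨k, hk⟩
    exact h ⟨k, by linarith⟩
  · simp
  · simp

/-- Two boxes whose first entries are congruent have equal first entries. -/
theorem fst_eq_of_add_mul {c d : CylDiagram n} {k : ℤ} (h : d.1.1 = c.1.1 + k * n) :
    d.1.1 = c.1.1 := by
  have hk : k = 0 := by
    have hc := c.2
    have hd := d.2
    have hn := n_pos (n := n)
    by_contra hk
    rcases lt_or_gt_of_ne hk with h' | h' <;> nlinarith
  simpa [hk] using h

theorem Rep.fst_eq {c d : CylDiagram n} {a b b' : ℤ} (hc : Rep c a b) (hd : Rep d a b') :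
    c.1.1 = d.1.1 := by
  obtain ⟨r, h1, -⟩ := hc
  obtain ⟨s, h2, -⟩ := hd
  exact fst_eq_of_add_mul (k := s - r) (by linarith)

theorem Rep.unique {c d : CylDiagram n} {a b : ℤ} (hc : Rep c a b) (hd : Rep d a b) : c = d := by
  have h := hc.fst_eq hd
  obtain ⟨r, h1, h3⟩ := hc
  obtain ⟨s, h2, h4⟩ := hd
  exact Subtype.ext (Prod.ext h (by linarith))

theorem Rep.mem_affineInv {c : CylDiagram n} {a b : ℤ} (h : Rep c a b) (u : affinePerm n) :
    c ∈ affineInv u ↔ pos u b < pos u a := by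
  obtain ⟨r, rfl, rfl⟩ := h
  rw [pos_add_mul, pos_add_mul, add_lt_add_iff_right]
  rfl

theorem affineInv_one : affineInv (1 : affinePerm n) = ∅ := by
  ext c
  rw [(rep_self c).mem_affineInv]
  have := (rep_self c).lt
  simp
  exact this.le

theorem affineInv_finite (u : affinePerm n) : (affineInv u).Finite := by
  -- The displacement `u⁻¹ x - x` is periodic, hence bounded.
  obtain ⟨M, hM⟩ : ∃ M : ℤ, ∀ x : ℤ, |pos u x - x| ≤ M := by
    obtain ⟨M, hM⟩ := ((Finset.Icc (0 : ℤ) n).image fun x => |pos u x - x|).bddAbove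
    refine ⟨M, fun x => ?_⟩
    have hn := n_pos (n := n)
    have h1 := Int.emod_nonneg x hn.ne'
    have h2 := Int.emod_lt_of_pos x hn
    have h3 := pos_add_mul u (x % n) (x / n)
    have h4 : x % n + x / n * n = x := by rw [mul_comm]; exact Int.emod_add_mul_ediv x n
    rw [h4] at h3
    have h5 : pos u x - x = pos u (x % n) - x % n := by linarith
    rw [h5]
    refine hM ?_
    simp only [Finset.coe_image, Set.mem_image, Finset.mem_coe, Finset.mem_Icc]
    exact ⟨x % n, ⟨h1, h2.le⟩, rfl⟩
  refine Set.Finite.of_finite_image (f := Subtype.val)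
    (((Set.finite_Icc (1 : ℤ) n).prod (Set.finite_Icc (1 : ℤ) (n + 2 * M))).subset ?_)
    Subtype.val_injective.injOn
  rintro _ ⟨c, hc, rfl⟩
  rw [(rep_self c).mem_affineInv] at hc
  have h1 := abs_le.mp (hM c.1.1)
  have h2 := abs_le.mp (hM c.1.2)
  have h3 := c.2
  refine ⟨⟨h3.1, h3.2.1⟩, ?_, ?_⟩ <;> linarith

/-- An increasing affine permutation is a translation, and the normalization of the sum over a
window makes this translation trivial. -/
theorem eq_one_of_increasing (u : affinePerm n) (h : ∀ p, u.1 p < u.1 (p + 1)) : u = 1 := by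
  have hmono : StrictMono u.1 := strictMono_int_of_lt_succ h
  have hsucc : ∀ p, u.1 (p + 1) = u.1 p + 1 := by
    intro p
    obtain ⟨q, hq⟩ := u.1.surjective (u.1 p + 1)
    have h1 : p < q := hmono.lt_iff_lt.mp (by omega)
    have h2 : u.1 (p + 1) ≤ u.1 q := hmono.monotone (by omega)
    have h3 := h p
    omega
  have htrans : ∀ p, u.1 p = u.1 0 + p := by
    intro p
    induction p using Int.induction_on with
    | zero => simp
    | succ i ih => rw [hsucc, ih]; ring
    | pred i ih =>
      have := hsucc (-(i : ℤ) - 1)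
      rw [show -(i : ℤ) - 1 + 1 = -(i : ℤ) by ring, ih] at this
      linarith
  have hsum := (sum_eq_iff n u.1).mp u.2.2
  have h0 : u.1 0 = 0 := by
    have : ∀ q ∈ Finset.Icc (1 : ℤ) n, u.1 q - q = u.1 0 := fun q _ => by rw [htrans]; ring
    rw [Finset.sum_congr rfl this] at hsum
    simp only [Finset.sum_const, Int.card_Icc, nsmul_eq_mul, mul_eq_zero] at hsum
    have := n_pos (n := n)
    rcases hsum with h | h
    · exfalso
      have h' : ((n : ℤ) + 1 - 1).toNat = 0 := by exact_mod_cast h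
      omega
    · exact h
  refine Subtype.ext (Equiv.ext fun p => ?_)
  rw [htrans, h0]
  simp

/-- In the weak order, an element `u` strictly below `w` has an ascent which is inverted by `w`. -/
theorem exists_ascent {u w : affinePerm n} (hsub : affineInv u ⊆ affineInv w) (hne : u ≠ w) :
    ∃ p, u.1 p < u.1 (p + 1) ∧ pos w (u.1 (p + 1)) < pos w (u.1 p) := by
  have h1 : w⁻¹ * u ≠ 1 := fun h => hne (inv_mul_eq_one.mp h).symm
  obtain ⟨p, hp⟩ : ∃ p, ¬ (w⁻¹ * u).1 p < (w⁻¹ * u).1 (p + 1) := by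
    by_contra! h
    exact h1 (eq_one_of_increasing _ h)
  have hp' : pos w (u.1 (p + 1)) ≤ pos w (u.1 p) := not_lt.mp hp
  have hne' : pos w (u.1 (p + 1)) ≠ pos w (u.1 p) := by
    rw [Ne, pos_inj, u.1.injective.eq_iff]
    omega
  refine ⟨p, ?_, lt_of_le_of_ne hp' hne'⟩
  by_contra hlt
  have hlt' : u.1 (p + 1) < u.1 p := by
    refine lt_of_le_of_ne (not_lt.mp hlt) ?_
    rw [Ne, u.1.injective.eq_iff]
    omega
  obtain ⟨c, hc⟩ := exists_rep hlt' fun h => not_apply_succ_modEq u p h.symm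
  have h2 : c ∈ affineInv u := by
    rw [hc.mem_affineInv, pos_apply, pos_apply]
    omega
  have h3 := (hc.mem_affineInv w).mp (hsub h2)
  omega

theorem affineInv_injective : Function.Injective (affineInv : affinePerm n → _) := by
  intro u w h
  by_contra hne
  obtain ⟨p, h1, h2⟩ := exists_ascent h.subset hne
  obtain ⟨c, hc⟩ := exists_rep h1 (not_apply_succ_modEq u p)
  have h3 := (hc.mem_affineInv w).mpr h2
  rw [← h, hc.mem_affineInv, pos_apply, pos_apply] at h3
  omega

theorem simpleRefl_mul_self (i : ZMod n) : simpleRefl n i * simpleRefl n i = 1 :=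
  Subtype.ext (Equiv.ext fun q => simpleFun_involutive n i q)

theorem pos_simpleRefl (i : ZMod n) (q : ℤ) : pos (simpleRefl n i) q = simpleFun n i q := by
  have h : (simpleRefl n i)⁻¹ = simpleRefl n i := inv_eq_of_mul_eq_one_right (simpleRefl_mul_self i)
  show ((simpleRefl n i)⁻¹).1 q = _
  rw [h]
  rfl

/-- Exchanging the entries at positions `p` and `p + 1` (and their translates) at an ascent adds
exactly one inversion. -/
theorem affineInv_mul_simpleRefl {u : affinePerm n} {p : ℤ} (hp : u.1 p < u.1 (p + 1))
    {c : CylDiagram n} (hc : Rep c (u.1 p) (u.1 (p + 1))) :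
    affineInv (u * simpleRefl n p) = insert c (affineInv u) := by
  ext d
  rw [Set.mem_insert_iff, (rep_self d).mem_affineInv, (rep_self d).mem_affineInv, pos_mul, pos_mul,
    pos_simpleRefl, pos_simpleRefl]
  have hd := (rep_self d).lt
  have hx := apply_pos u d.1.1
  have hy := apply_pos u d.1.2
  generalize pos u d.1.1 = a at *
  generalize pos u d.1.2 = b at *
  have hab : a ≠ b := by
    rintro rfl
    omega
  constructor
  · intro hlt
    by_cases hba : b < a
    · exact Or.inr hba
    left
    have h1 : ∃ k : ℤ, a = p + k * n ∧ b = a + 1 := by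
      rcases simpleFun_cases (n := n) p a with ⟨⟨k, hk⟩, h⟩ | ⟨-, h⟩ | ⟨-, -, h⟩ <;>
      rcases simpleFun_cases (n := n) p b with ⟨-, h'⟩ | ⟨-, h'⟩ | ⟨-, -, h'⟩ <;>
      try omega
      exact ⟨k, hk, by omega⟩
    obtain ⟨k, hk, rfl⟩ := h1
    rw [hk, apply_add_mul] at hx
    rw [hk, show p + k * n + 1 = p + 1 + k * n by ring, apply_add_mul] at hy
    refine Rep.unique (rep_self d) ?_
    rw [← hx, ← hy]
    exact hc.shift k
  · rintro (rfl | hba)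
    · obtain ⟨k, h1, h2⟩ := hc.exists_shift (rep_self d)
      rw [h1, ← apply_add_mul, u.1.injective.eq_iff] at hx
      rw [h2, ← apply_add_mul, u.1.injective.eq_iff] at hy
      rcases simpleFun_cases (n := n) p a with ⟨-, h⟩ | ⟨⟨k', hk'⟩, h⟩ | ⟨h3, -, h⟩
      · rcases simpleFun_cases (n := n) p b with ⟨⟨k', hk'⟩, h'⟩ | ⟨-, h'⟩ | ⟨-, h3, h'⟩
        · exfalso
          refine not_succ_modEq (n := n) p ?_
          rw [modEq_iff_exists]
          exact ⟨k' - k, by linarith⟩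
        · omega
        · exact absurd ⟨k, hy⟩ h3
      · exfalso
        refine not_succ_modEq (n := n) p ?_
        rw [modEq_iff_exists]
        exact ⟨k - k', by linarith⟩
      · exact absurd ⟨k, hx⟩ h3
    · have key : ∀ k : ℤ, b = p + k * n → a ≠ b + 1 := by
        rintro k hk rfl
        rw [show b + 1 = p + 1 + k * n by omega, apply_add_mul] at hx
        rw [hk, apply_add_mul] at hy
        omega
      rcases simpleFun_cases (n := n) p a with ⟨⟨k, hk⟩, h⟩ | ⟨⟨k, hk⟩, h⟩ | ⟨-, h3, h⟩ <;>
      rcases simpleFun_cases (n := n) p b with ⟨⟨k', hk'⟩, h'⟩ | ⟨⟨k', hk'⟩, h'⟩ | ⟨h4, -, h'⟩ <;>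
      try omega
      · have := key k' hk'
        by_contra hcon
        have h5 : a = b + 2 ∨ a = b + 1 := by omega
        rcases h5 with h5 | h5
        · refine not_succ_modEq (n := n) p ?_
          rw [modEq_iff_exists]
          exact ⟨k - k', by linarith⟩
        · exact this h5
      · by_contra hcon
        have h5 : a = b + 1 := by omega
        exact h4 ⟨k, by omega⟩
      · by_contra hcon
        have h5 : a = b + 1 := by omega
        exact key k' hk' h5

/-! ### Length and inversions of products -/

/-- The action of `u` on unordered pairs of values, as a permutation of the boxes. -/
theorem exists_relabel (u : affinePerm n) : ∃ φ : CylDiagram n → CylDiagram n,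
    Function.Bijective φ ∧
      ∀ c, Rep (φ c) (u.1 c.1.1) (u.1 c.1.2) ∨ Rep (φ c) (u.1 c.1.2) (u.1 c.1.1) := by
  have hex : ∀ c : CylDiagram n, ∃ d : CylDiagram n,
      Rep d (u.1 c.1.1) (u.1 c.1.2) ∨ Rep d (u.1 c.1.2) (u.1 c.1.1) := by
    intro c
    have h := (rep_self c).not_modEq
    rw [← apply_modEq_iff u] at h
    rcases lt_trichotomy (u.1 c.1.1) (u.1 c.1.2) with h1 | h1 | h1
    · obtain ⟨d, hd⟩ := exists_rep h1 h
      exact ⟨d, Or.inl hd⟩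
    · exact absurd (by rw [h1]) h
    · obtain ⟨d, hd⟩ := exists_rep h1 fun h' => h h'.symm
      exact ⟨d, Or.inr hd⟩
  choose φ hφ using hex
  refine ⟨φ, ⟨?_, ?_⟩, hφ⟩
  · intro c d hcd
    have hc := hφ c
    have hd := hφ d
    rw [hcd] at hc
    have h1 := (rep_self c).lt
    have h2 := (rep_self d).lt
    have key : ∀ {a b a' b' : ℤ}, Rep (φ d) (u.1 a) (u.1 b) → Rep (φ d) (u.1 a') (u.1 b') →
        ∃ k : ℤ, a' = a + k * n ∧ b' = b + k * n := by
      intro a b a' b' h h'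
      obtain ⟨k, h3, h4⟩ := h.exists_shift h'
      refine ⟨k, ?_, ?_⟩
      · rwa [← apply_add_mul, u.1.injective.eq_iff] at h3
      · rwa [← apply_add_mul, u.1.injective.eq_iff] at h4
    rcases hc with hc | hc <;> rcases hd with hd | hd <;> obtain ⟨k, h3, h4⟩ := key hc hd
    · refine ((rep_self d).unique ?_).symm
      rw [h3, h4]
      exact (rep_self c).shift k
    · omega
    · omega
    · refine ((rep_self d).unique ?_).symm
      rw [h3, h4]
      exact (rep_self c).shift k
  · intro d
    have h := (rep_self d).not_modEq
    rw [← pos_modEq_iff u] at h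
    have key : ∀ {c : CylDiagram n} {a b : ℤ}, Rep c a b →
        Rep (φ c) (u.1 a) (u.1 b) ∨ Rep (φ c) (u.1 b) (u.1 a) := by
      intro c a b hc
      obtain ⟨k, rfl, rfl⟩ := (rep_self c).exists_shift hc
      rw [apply_add_mul, apply_add_mul]
      exact (hφ c).imp (fun h => h.shift k) (fun h => h.shift k)
    have hlt := (rep_self d).lt
    rcases lt_trichotomy (pos u d.1.1) (pos u d.1.2) with h1 | h1 | h1
    · obtain ⟨c, hc⟩ := exists_rep h1 h
      have := key hc
      rw [apply_pos, apply_pos] at this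
      rcases this with h2 | h2
      · exact ⟨c, h2.unique (rep_self d)⟩
      · exact absurd h2.lt hlt.not_gt
    · exact absurd (by rw [h1]) h
    · obtain ⟨c, hc⟩ := exists_rep h1 fun h' => h h'.symm
      have := key hc
      rw [apply_pos, apply_pos] at this
      rcases this with h2 | h2
      · exact absurd h2.lt hlt.not_gt
      · exact ⟨c, h2.unique (rep_self d)⟩

/-- The inversion set of a product is the symmetric difference of the inversion sets of the
factors, the second one being moved by the first factor. -/
theorem exists_affineInv_mul_eq (u : affinePerm n) : ∃ φ : CylDiagram n → CylDiagram n,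
    Function.Bijective φ ∧
      (∀ c, φ c ∉ affineInv u → Rep (φ c) (u.1 c.1.1) (u.1 c.1.2)) ∧
      ∀ v c, φ c ∈ affineInv (u * v) ↔ ¬ (φ c ∈ affineInv u ↔ c ∈ affineInv v) := by
  obtain ⟨φ, hbij, hφ⟩ := exists_relabel u
  refine ⟨φ, hbij, ?_, ?_⟩
  · intro c hc
    rcases hφ c with h | h
    · exact h
    · rw [h.mem_affineInv, pos_apply, pos_apply] at hc
      exact absurd (rep_self c).lt hc
  · intro v c
    have hlt := (rep_self c).lt
    rw [(rep_self c).mem_affineInv v]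
    have hne : pos v c.1.1 ≠ pos v c.1.2 := by
      rw [Ne, pos_inj]
      exact hlt.ne
    rcases hφ c with h | h <;>
    · rw [h.mem_affineInv, h.mem_affineInv, pos_mul, pos_mul]
      simp only [pos_apply]
      omega

theorem ncard_affineInv_mul (u v : affinePerm n) : ∃ s : Set (CylDiagram n), s.Finite ∧
    (affineInv (u * v)).ncard + 2 * s.ncard = (affineInv u).ncard + (affineInv v).ncard ∧
      (s = ∅ ↔ affineInv u ⊆ affineInv (u * v)) := by
  obtain ⟨φ, hbij, -, hφ⟩ := exists_affineInv_mul_eq u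
  have hX := affineInv_finite u
  have hY : (φ '' affineInv v).Finite := (affineInv_finite v).image φ
  have hmem : ∀ c, φ c ∈ φ '' affineInv v ↔ c ∈ affineInv v :=
    fun c => hbij.1.mem_set_image
  have hcard : (φ '' affineInv v).ncard = (affineInv v).ncard :=
    Set.ncard_image_of_injective _ hbij.1
  have hZ : affineInv (u * v) =
      (affineInv u \ φ '' affineInv v) ∪ (φ '' affineInv v \ affineInv u) := by
    ext d
    obtain ⟨c, rfl⟩ := hbij.2 d
    rw [hφ, Set.mem_union, Set.mem_sdiff, Set.mem_sdiff, hmem]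
    tauto
  refine ⟨affineInv u ∩ φ '' affineInv v, hX.inter_of_left _, ?_, ?_⟩
  · have h1 := Set.ncard_inter_add_ncard_sdiff_eq_ncard (affineInv u) (φ '' affineInv v) hX
    have h2 := Set.ncard_inter_add_ncard_sdiff_eq_ncard (φ '' affineInv v) (affineInv u) hY
    rw [Set.inter_comm] at h2
    rw [hZ, Set.ncard_union_eq (Set.disjoint_left.mpr fun d h h' => h.2 h'.1) hX.sdiff hY.sdiff]
    omega
  · rw [← Set.disjoint_iff_inter_eq_empty, Set.disjoint_left]
    constructor
    · intro h d hd
      rw [hZ]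
      exact Or.inl ⟨hd, h hd⟩
    · intro h d hd hd'
      have := h hd
      rw [hZ] at this
      rcases this with h1 | h1
      · exact h1.2 hd'
      · exact h1.2 hd

theorem ncard_affineInv_mul_le (u v : affinePerm n) :
    (affineInv (u * v)).ncard ≤ (affineInv u).ncard + (affineInv v).ncard := by
  obtain ⟨s, -, h, -⟩ := ncard_affineInv_mul u v
  omega

/-- Length-additive products are the order relations of the weak order, which is inclusion of
inversion sets. -/
theorem ncard_affineInv_mul_eq_iff (u v : affinePerm n) :
    (affineInv (u * v)).ncard = (affineInv u).ncard + (affineInv v).ncard ↔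
      affineInv u ⊆ affineInv (u * v) := by
  obtain ⟨s, hs, h, h'⟩ := ncard_affineInv_mul u v
  rw [← h', ← Set.ncard_eq_zero hs]
  omega

theorem simpleFun_succ (p : ℤ) : simpleFun n p (p + 1) = p := by
  have h := simpleFun_involutive n (p : ZMod n) p
  rwa [simpleFun_self] at h

theorem mul_simpleRefl_apply (u : affinePerm n) (p : ℤ) :
    (u * simpleRefl n p).1 p = u.1 (p + 1) := by
  show u.1 (simpleFun n p p) = _
  rw [simpleFun_self]

theorem mul_simpleRefl_apply_succ (u : affinePerm n) (p : ℤ) :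
    (u * simpleRefl n p).1 (p + 1) = u.1 p := by
  show u.1 (simpleFun n p (p + 1)) = _
  rw [simpleFun_succ]

/-- Removing a descent from an affine permutation other than the identity. -/
theorem exists_descent {v : affinePerm n} (hv : v ≠ 1) : ∃ (v' : affinePerm n) (p : ℤ)
    (c : CylDiagram n), v = v' * simpleRefl n p ∧ v'.1 p < v'.1 (p + 1) ∧
      Rep c (v'.1 p) (v'.1 (p + 1)) ∧ c ∉ affineInv v' ∧ affineInv v = insert c (affineInv v') := by
  obtain ⟨p, hp⟩ : ∃ p, ¬ v.1 p < v.1 (p + 1) := by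
    by_contra! h
    exact hv (eq_one_of_increasing _ h)
  have h1 : (v * simpleRefl n p).1 p < (v * simpleRefl n p).1 (p + 1) := by
    rw [mul_simpleRefl_apply, mul_simpleRefl_apply_succ]
    refine lt_of_le_of_ne (not_lt.mp hp) ?_
    rw [Ne, v.1.injective.eq_iff]
    omega
  obtain ⟨c, hc⟩ := exists_rep h1 (not_apply_succ_modEq _ p)
  have h2 : v = v * simpleRefl n p * simpleRefl n p := by
    rw [mul_assoc, simpleRefl_mul_self, mul_one]
  refine ⟨v * simpleRefl n p, p, c, h2, h1, hc, ?_, ?_⟩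
  · rw [hc.mem_affineInv, pos_apply, pos_apply]
    omega
  · rw [← affineInv_mul_simpleRefl h1 hc, ← h2]

theorem ncard_affineInv_simpleRefl (i : ZMod n) : (affineInv (simpleRefl n i)).ncard = 1 := by
  obtain ⟨p, rfl⟩ := ZMod.intCast_surjective i
  have h1 : (1 : affinePerm n).1 p < (1 : affinePerm n).1 (p + 1) := by simp
  obtain ⟨c, hc⟩ := exists_rep h1 (not_apply_succ_modEq _ p)
  have h := affineInv_mul_simpleRefl h1 hc
  rw [one_mul, affineInv_one] at h
  rw [h]
  simp

theorem ncard_affineInv_wordProd_le (l : List (ZMod n)) :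
    (affineInv (wordProd l)).ncard ≤ l.length := by
  induction l with
  | nil => simp [wordProd, affineInv_one]
  | cons i l ih =>
    have h : wordProd (i :: l) = simpleRefl n i * wordProd l := by simp [wordProd]
    rw [h]
    have h1 := ncard_affineInv_mul_le (simpleRefl n i) (wordProd l)
    rw [ncard_affineInv_simpleRefl] at h1
    simp only [List.length_cons]
    omega

theorem wordProd_append_singleton (l : List (ZMod n)) (i : ZMod n) :
    wordProd (l ++ [i]) = wordProd l * simpleRefl n i := by
  simp [wordProd]

theorem exists_word (v : affinePerm n) :
    ∃ l : List (ZMod n), wordProd l = v ∧ l.length = (affineInv v).ncard := by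
  induction hk : (affineInv v).ncard generalizing v with
  | zero =>
    refine ⟨[], ?_, rfl⟩
    rw [Set.ncard_eq_zero (affineInv_finite v), ← affineInv_one] at hk
    exact (affineInv_injective hk).symm
  | succ k ih =>
    have hv : v ≠ 1 := by
      rintro rfl
      simp [affineInv_one] at hk
    obtain ⟨v', p, c, rfl, -, -, hc, hins⟩ := exists_descent hv
    rw [hins, Set.ncard_insert_of_notMem hc (affineInv_finite v')] at hk
    obtain ⟨l, rfl, hl⟩ := ih v' (by omega)
    exact ⟨l ++ [(p : ZMod n)], wordProd_append_singleton l p, by simp [hl]⟩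

/-- The Coxeter length is the number of inversions. -/
theorem affineLength_eq_ncard (v : affinePerm n) : affineLength v = (affineInv v).ncard := by
  refine le_antisymm (Nat.sInf_le ?_) (le_csInf ?_ ?_)
  · obtain ⟨l, h1, h2⟩ := exists_word v
    exact ⟨l, h2, h1⟩
  · obtain ⟨l, h1, h2⟩ := exists_word v
    exact ⟨_, l, h2, h1⟩
  · rintro k ⟨l, rfl, rfl⟩
    exact ncard_affineInv_wordProd_le l

/-! ### Cyclically decreasing elements -/

/-- Cyclically decreasing words as a pairwise condition, suited to induction on either end. -/
theorem isCycDecWord_iff_pairwise (l : List (ZMod n)) :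
    IsCycDecWord l ↔ l.Pairwise fun i j => i ≠ j ∧ j ≠ i + 1 := by
  have : Fact (1 < n) := ⟨Nat.AtLeastTwo.prop⟩
  rw [List.pairwise_and_iff]
  refine and_congr Iff.rfl ?_
  rw [List.pairwise_iff_get]
  constructor
  · intro h p q hpq heq
    exact absurd (h p q heq) hpq.not_gt
  · intro h p q heq
    by_contra hlt
    rcases (not_lt.mp hlt).lt_or_eq with h2 | rfl
    · exact h p q h2 heq
    · simp at heq

theorem wordProd_cons_apply (i : ZMod n) (l : List (ZMod n)) (q : ℤ) :
    (wordProd (i :: l)).1 q = simpleFun n i ((wordProd l).1 q) := by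
  have h : wordProd (i :: l) = simpleRefl n i * wordProd l := by simp [wordProd]
  rw [h]
  rfl

/-- A cyclically decreasing product moves the entry at position `p + 1` one step to the left for
each of its letters `p`. -/
theorem wordProd_apply_succ {l : List (ZMod n)} (hl : IsCycDecWord l) {p : ℤ}
    (hp : (p : ZMod n) ∈ l) : (wordProd l).1 (p + 1) = p := by
  rw [isCycDecWord_iff_pairwise] at hl
  have hfix : ∀ (l : List (ZMod n)) (q : ℤ), (q : ZMod n) ∉ l → (q : ZMod n) - 1 ∉ l →
      (wordProd l).1 q = q := by
    intro l q
    induction l with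
    | nil => intros; rfl
    | cons i l ih =>
      intro h1 h2
      rw [List.mem_cons, not_or] at h1 h2
      rw [wordProd_cons_apply, ih h1.2 h2.2, simpleFun, if_neg h1.1, if_neg]
      intro h
      exact h2.1 (by rw [h]; ring)
  induction l with
  | nil => simp at hp
  | cons i l ih =>
    rw [List.pairwise_cons] at hl
    rw [wordProd_cons_apply]
    by_cases hpl : (p : ZMod n) ∈ l
    · rw [ih hl.2 hpl, simpleFun, if_neg (hl.1 _ hpl).1.symm, if_neg (hl.1 _ hpl).2]
    · have hpi : (p : ZMod n) = i := by
        rcases List.mem_cons.mp hp with h | h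
        · exact h
        · exact absurd h hpl
      subst hpi
      rw [hfix l (p + 1), simpleFun_succ]
      · intro h
        exact (hl.1 _ h).2 (by push_cast; rfl)
      · push_cast
        rwa [add_sub_cancel_right]

/-- An entry of a cyclically decreasing product at a position `q` such that `q - 1` is not a letter
moves weakly to the right, through letters only. -/
theorem wordProd_apply_ge {l : List (ZMod n)} (hl : IsCycDecWord l) {q : ℤ}
    (hq : ((q - 1 : ℤ) : ZMod n) ∉ l) :
    q ≤ (wordProd l).1 q ∧ ∀ t, q ≤ t → t < (wordProd l).1 q → (t : ZMod n) ∈ l := by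
  rw [isCycDecWord_iff_pairwise] at hl
  induction l with
  | nil =>
    have h : (wordProd ([] : List (ZMod n))).1 q = q := rfl
    rw [h]
    exact ⟨le_rfl, fun t h1 h2 => by omega⟩
  | cons i l ih =>
    rw [List.pairwise_cons] at hl
    rw [List.mem_cons, not_or] at hq
    obtain ⟨h1, h2⟩ := ih hl.2 hq.2
    rw [wordProd_cons_apply, simpleFun]
    generalize (wordProd l).1 q = w at *
    split_ifs with h3 h4
    · refine ⟨by omega, fun t h5 h6 => ?_⟩
      rcases (show t ≤ w by omega).lt_or_eq with h7 | rfl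
      · exact List.mem_cons_of_mem _ (h2 t h5 h7)
      · rw [h3]
        exact List.mem_cons_self
    · exfalso
      have h5 : ((w - 1 : ℤ) : ZMod n) = i := by
        push_cast
        rw [h4]
        ring
      rcases h1.lt_or_eq with h6 | rfl
      · have h7 := h2 (w - 1) (by omega) (by omega)
        rw [h5] at h7
        exact (hl.1 _ h7).1 rfl
      · exact hq.1 h5
    · exact ⟨h1, fun t h5 h6 => List.mem_cons_of_mem _ (h2 t h5 h6)⟩

/-- A cyclically decreasing word misses a letter: the letter following its first one. Hence below
each letter `p` there is the beginning `q` of a run `q, …, p` of letters, and the entry at `q` ends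
up to the right of that run. -/
theorem exists_lt_wordProd_apply {l : List (ZMod n)} (hl : IsCycDecWord l) {p : ℤ}
    (hp : (p : ZMod n) ∈ l) : ∃ q ≤ p, p < (wordProd l).1 q := by
  obtain ⟨j, hj⟩ : ∃ j : ℤ, (j : ZMod n) ∉ l := by
    cases l with
    | nil => simp at hp
    | cons i l =>
      rw [isCycDecWord_iff_pairwise, List.pairwise_cons] at hl
      obtain ⟨j, rfl⟩ := ZMod.intCast_surjective i
      refine ⟨j + 1, ?_⟩
      rw [List.mem_cons, not_or]
      refine ⟨?_, fun h => (hl.1 _ h).2 (by push_cast; rfl)⟩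
      intro h
      have := not_succ_modEq (n := n) j
      rw [← ZMod.intCast_eq_intCast_iff] at this
      exact this h
  have hper : ∀ k : ℤ, ((j + k * n : ℤ) : ZMod n) = j := by
    intro k
    push_cast
    simp
  obtain ⟨t, ⟨ht1, ht2⟩, htmax⟩ := Int.exists_greatest_of_bdd
    (P := fun t : ℤ => (t : ZMod n) ∉ l ∧ t ≤ p) ⟨p, fun t ht => ht.2⟩ (by
      refine ⟨j + (-|p - j|) * n, ?_, ?_⟩
      · rwa [hper]
      · have h1 := two_le (n := n)
        have h2 := neg_abs_le (p - j)
        have h3 := abs_nonneg (p - j)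
        nlinarith)
  have htp : t ≠ p := by
    rintro rfl
    exact ht1 hp
  refine ⟨t + 1, by omega, ?_⟩
  obtain ⟨h1, -⟩ := wordProd_apply_ge hl (q := t + 1) (by simpa using ht1)
  by_contra hlt
  have h3 : (((wordProd l).1 (t + 1) : ℤ) : ZMod n) ∈ l := by
    by_contra h4
    have := htmax _ ⟨h4, not_lt.mp hlt⟩
    omega
  have h4 := wordProd_apply_succ hl h3
  rw [(wordProd l).1.injective.eq_iff] at h4
  omega

/-- The boxes of `s` lie in pairwise distinct columns. -/
def ColDistinct (s : Set (CylDiagram n)) : Prop :=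
  ∀ c ∈ s, ∀ d ∈ s, d.1.1 = c.1.1 → c = d

/-- In a cyclically decreasing element every value has at most one larger value to its left, since
such a value sits at the beginning of the run of letters through which it has moved. -/
theorem IsCycDec.colDistinct {v : affinePerm n} (hv : IsCycDec v) : ColDistinct (affineInv v) := by
  obtain ⟨l, hl, rfl, -⟩ := hv
  have key : ∀ c ∈ affineInv (wordProd l),
      ((pos (wordProd l) c.1.2 - 1 : ℤ) : ZMod n) ∉ l ∧
      pos (wordProd l) c.1.2 < pos (wordProd l) c.1.1 ∧
      ∀ t, pos (wordProd l) c.1.2 ≤ t → t < pos (wordProd l) c.1.1 → (t : ZMod n) ∈ l := by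
    intro c hc
    rw [(rep_self c).mem_affineInv] at hc
    have hlt := (rep_self c).lt
    have hx := apply_pos (wordProd l) c.1.1
    have hy := apply_pos (wordProd l) c.1.2
    generalize pos (wordProd l) c.1.1 = p at *
    generalize pos (wordProd l) c.1.2 = q at *
    have hpy : p ≤ c.1.2 := by
      by_cases hp : ((p - 1 : ℤ) : ZMod n) ∈ l
      · have := wordProd_apply_succ hl hp
        rw [sub_add_cancel, hx] at this
        omega
      · have := (wordProd_apply_ge hl hp).1
        omega
    have hq : ((q - 1 : ℤ) : ZMod n) ∉ l := by
      intro hq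
      have := wordProd_apply_succ hl hq
      rw [sub_add_cancel, hy] at this
      omega
    refine ⟨hq, hc, fun t h1 h2 => (wordProd_apply_ge hl hq).2 t h1 ?_⟩
    omega
  intro c hc d hd hcd
  obtain ⟨h1, h2, h3⟩ := key c hc
  obtain ⟨h4, h5, h6⟩ := key d hd
  rw [hcd] at h5 h6
  have : pos (wordProd l) c.1.2 = pos (wordProd l) d.1.2 := by
    rcases lt_trichotomy (pos (wordProd l) c.1.2) (pos (wordProd l) d.1.2) with h | h | h
    · exact absurd (h3 _ (by omega) (by omega)) h4
    · exact h
    · exact absurd (h6 _ (by omega) (by omega)) h1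
  exact Subtype.ext (Prod.ext hcd.symm (pos_inj.mp this))

/-- Conversely, a reduced word is built from the left. The box created by the last letter `p`
belongs to the column of the entry of the preceding element at position `p`. If `p - 1` were an
earlier letter, this column would already contain a box; if `p` were one and `p - 1` not, `p` would
not be an ascent. -/
theorem exists_isCycDecWord_of_colDistinct (v : affinePerm n) (hv : ColDistinct (affineInv v)) :
    ∃ l : List (ZMod n), IsCycDecWord l ∧ wordProd l = v ∧ l.length = (affineInv v).ncard := by
  induction hk : (affineInv v).ncard generalizing v with
  | zero =>
    refine ⟨[], ⟨by simp, fun p => p.elim0⟩, ?_, rfl⟩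
    rw [Set.ncard_eq_zero (affineInv_finite v), ← affineInv_one] at hk
    exact (affineInv_injective hk).symm
  | succ k ih =>
    have hv1 : v ≠ 1 := by
      rintro rfl
      simp [affineInv_one] at hk
    obtain ⟨v', p, c, rfl, hasc, hrep, hc, hins⟩ := exists_descent hv1
    rw [hins, Set.ncard_insert_of_notMem hc (affineInv_finite v')] at hk
    rw [hins] at hv
    obtain ⟨l, hl, rfl, hlen⟩ := ih v'
      (fun c hc d hd => hv c (Or.inr hc) d (Or.inr hd)) (by omega)
    have hpred : ((p - 1 : ℤ) : ZMod n) ∉ l := by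
      intro hmem
      have h1 := wordProd_apply_succ hl hmem
      rw [sub_add_cancel] at h1
      obtain ⟨q, hq, hq'⟩ := exists_lt_wordProd_apply hl hmem
      have hncong : ¬ (wordProd l).1 q ≡ p - 1 [ZMOD n] := by
        intro h
        rw [← h1, modEq_iff_exists] at h
        obtain ⟨m, hm⟩ := h
        rw [← apply_add_mul, (wordProd l).1.injective.eq_iff] at hm
        have h2 := apply_add_mul (wordProd l) p m
        rw [← hm, h1] at h2
        omega
      obtain ⟨d, hd⟩ := exists_rep hq' hncong
      have hdmem : d ∈ affineInv (wordProd l) := by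
        rw [hd.mem_affineInv, pos_apply, ← h1, pos_apply]
        omega
      rw [h1] at hrep
      refine hc ?_
      rw [hv c (Or.inl rfl) d (Or.inr hdmem) (hd.fst_eq hrep)]
      exact hdmem
    have hself : (p : ZMod n) ∉ l := by
      intro hmem
      rw [wordProd_apply_succ hl hmem] at hasc
      have := (wordProd_apply_ge hl hpred).1
      omega
    refine ⟨l ++ [(p : ZMod n)], ?_, wordProd_append_singleton l p, by simp [hlen]⟩
    rw [isCycDecWord_iff_pairwise] at hl ⊢
    rw [List.pairwise_append]
    refine ⟨hl, List.pairwise_singleton _ _, ?_⟩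
    intro i hi j hj
    rw [List.mem_singleton] at hj
    subst hj
    refine ⟨fun h => hself (h ▸ hi), fun h => hpred ?_⟩
    push_cast
    rwa [h, add_sub_cancel_right]

theorem isCycDec_iff_colDistinct (v : affinePerm n) :
    IsCycDec v ↔ ColDistinct (affineInv v) := by
  refine ⟨IsCycDec.colDistinct, fun h => ?_⟩
  obtain ⟨l, h1, h2, h3⟩ := exists_isCycDecWord_of_colDistinct v h
  exact ⟨l, h1, h2, by rw [h3, affineLength_eq_ncard]⟩

/-- For a length-additive product `u v`, the columns of the new inversions are distinct if and only
if `v` is cyclically decreasing: `u` permutes the columns. -/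
theorem colDistinct_sdiff_iff {u v : affinePerm n} (h : affineInv u ⊆ affineInv (u * v)) :
    ColDistinct (affineInv (u * v) \ affineInv u) ↔ IsCycDec v := by
  rw [isCycDec_iff_colDistinct]
  obtain ⟨φ, hbij, hrep, hφ⟩ := exists_affineInv_mul_eq u
  have hmem : ∀ c, φ c ∈ affineInv (u * v) \ affineInv u ↔ c ∈ affineInv v := by
    intro c
    have := @h (φ c)
    rw [hφ] at this
    rw [Set.mem_sdiff, hφ]
    tauto
  have hcol : ∀ c ∈ affineInv v, ∀ d ∈ affineInv v,
      ((φ d).1.1 = (φ c).1.1 ↔ d.1.1 = c.1.1) := by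
    intro c hc d hd
    have h1 := hrep c ((hmem c).mpr hc).2
    have h2 := hrep d ((hmem d).mpr hd).2
    constructor
    · intro heq
      obtain ⟨r, h3, -⟩ := h1
      obtain ⟨s, h4, -⟩ := h2
      have h5 : u.1 d.1.1 = u.1 c.1.1 + (s - r) * n := by
        rw [h3, h4, heq]
        ring
      rw [← apply_add_mul, u.1.injective.eq_iff] at h5
      exact fst_eq_of_add_mul h5
    · intro heq
      rw [heq] at h2
      exact h2.fst_eq h1
  constructor
  · intro hd c hc d hd' heq
    exact hbij.1 (hd _ ((hmem c).mpr hc) _ ((hmem d).mpr hd') ((hcol c hc d hd').mpr heq))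
  · intro hd c' hc d' hd' heq
    obtain ⟨c, rfl⟩ := hbij.2 c'
    obtain ⟨d, rfl⟩ := hbij.2 d'
    rw [hmem] at hc hd'
    rw [hd c hc d hd' ((hcol c hc d hd').mp heq)]

end AffinePerm

/-! ### Peeling lists of a valued digraph -/

namespace ValuedDigraph

variable {V : Type*}

theorem isPeeling_append (𝒢 : ValuedDigraph V) (L M : List V) :
    𝒢.IsPeeling (L ++ M) ↔ 𝒢.IsPeeling L ∧ (L.foldl erase 𝒢).IsPeeling M := by
  induction L generalizing 𝒢 with
  | nil => simp [IsPeeling]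
  | cons x L ih => simp [IsPeeling, ih, and_assoc]

theorem mem_verts_foldl_erase (𝒢 : ValuedDigraph V) (L : List V) (x : V) :
    x ∈ (L.foldl erase 𝒢).verts ↔ x ∈ 𝒢.verts ∧ x ∉ L := by
  induction L generalizing 𝒢 with
  | nil => simp
  | cons y L ih =>
    rw [List.foldl_cons, ih, List.mem_cons, not_or, ← and_assoc]
    rfl

theorem adj_foldl_erase (𝒢 : ValuedDigraph V) (L : List V) (x y : V) :
    (L.foldl erase 𝒢).graph.Adj x y ↔ 𝒢.graph.Adj x y ∧ x ∉ L ∧ y ∉ L := by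
  induction L generalizing 𝒢 with
  | nil => simp
  | cons z L ih =>
    rw [List.foldl_cons, ih]
    simp only [erase, List.mem_cons, not_or]
    tauto

theorem val_foldl_erase (𝒢 : ValuedDigraph V) {L : List V} (hL : L.Nodup) {x : V} (hx : x ∉ L) :
    (L.foldl erase 𝒢).val x = 𝒢.val x - {y | y ∈ L ∧ 𝒢.graph.Adj x y}.ncard := by
  induction L generalizing 𝒢 with
  | nil => simp
  | cons z L ih =>
    rw [List.nodup_cons] at hL
    rw [List.mem_cons, not_or] at hx
    have hset : {y | y ∈ L ∧ (𝒢.erase z).graph.Adj x y} = {y | y ∈ L ∧ 𝒢.graph.Adj x y} := by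
      ext y
      simp only [erase, Set.mem_ofPred_eq]
      refine and_congr_right fun hy => ⟨fun h => h.1, fun h => ⟨h, hx.1, ?_⟩⟩
      rintro rfl
      exact hL.1 hy
    have hfin : {y | y ∈ L ∧ 𝒢.graph.Adj x y}.Finite :=
      (List.finite_toSet L).subset fun y hy => hy.1
    rw [List.foldl_cons, ih _ hL.2 hx.2, hset]
    by_cases h : 𝒢.graph.Adj x z
    · have h1 : {y | y ∈ z :: L ∧ 𝒢.graph.Adj x y} =
          insert z {y | y ∈ L ∧ 𝒢.graph.Adj x y} := by
        ext y
        simp only [List.mem_cons, Set.mem_ofPred_eq, Set.mem_insert_iff]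
        constructor
        · rintro ⟨rfl | h2, h3⟩
          · exact Or.inl rfl
          · exact Or.inr ⟨h2, h3⟩
        · rintro (rfl | h2)
          · exact ⟨Or.inl rfl, h⟩
          · exact ⟨Or.inr h2.1, h2.2⟩
      rw [h1, Set.ncard_insert_of_notMem (fun h2 => hL.1 h2.1) hfin]
      simp only [erase, if_pos h]
      omega
    · have h1 : {y | y ∈ z :: L ∧ 𝒢.graph.Adj x y} = {y | y ∈ L ∧ 𝒢.graph.Adj x y} := by
        ext y
        simp only [List.mem_cons, Set.mem_ofPred_eq]
        constructor
        · rintro ⟨rfl | h2, h3⟩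
          · exact absurd h3 h
          · exact ⟨h2, h3⟩
        · exact fun h2 => ⟨Or.inr h2.1, h2.2⟩
      rw [h1]
      simp only [erase, if_neg h]

theorem IsPeeling.nodup {𝒢 : ValuedDigraph V} {L : List V} (h : 𝒢.IsPeeling L) : L.Nodup := by
  have key : ∀ (𝒢 : ValuedDigraph V), 𝒢.IsPeeling L → L.Nodup ∧ ∀ x ∈ L, x ∈ 𝒢.verts := by
    clear h
    induction L with
    | nil => simp
    | cons x L ih =>
      rintro 𝒢 ⟨h1, h2⟩
      obtain ⟨h3, h4⟩ := ih _ h2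
      refine ⟨List.nodup_cons.mpr ⟨fun hx => (h4 x hx).2 rfl, h3⟩, ?_⟩
      intro y hy
      rcases List.mem_cons.mp hy with rfl | hy
      · exact h1.1
      · exact (h4 y hy).1
  exact (key 𝒢 h).1

/-- Erasability after the peeling of `L`, in terms of the initial digraph: the current value of a
vertex is its initial value, lowered by the number of its out-neighbours in `L`. -/
theorem isPeeling_concat (𝒢 : ValuedDigraph V) (L : List V) (x : V) :
    𝒢.IsPeeling (L ++ [x]) ↔ 𝒢.IsPeeling L ∧ x ∈ 𝒢.verts ∧ x ∉ L ∧
      𝒢.val x ≤ {y | y ∈ L ∧ 𝒢.graph.Adj x y}.ncard ∧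
      ∀ z, z ∉ L → 𝒢.graph.Adj z x → {y | y ∈ L ∧ 𝒢.graph.Adj z y}.ncard < 𝒢.val z := by
  rw [isPeeling_append]
  refine and_congr_right fun hL => ?_
  have hnd := hL.nodup
  simp only [IsPeeling, and_true, Erasable, mem_verts_foldl_erase, and_assoc]
  refine and_congr_right fun _ => and_congr_right fun hx => ?_
  rw [val_foldl_erase 𝒢 hnd hx, Nat.sub_eq_zero_iff_le]
  refine and_congr_right fun _ => forall_congr' fun z => ?_
  rw [adj_foldl_erase]
  constructor
  · intro h hz hadj
    have := h ⟨hadj, hz, hx⟩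
    rw [val_foldl_erase 𝒢 hnd hz] at this
    omega
  · rintro h ⟨hadj, hz, -⟩
    rw [val_foldl_erase 𝒢 hnd hz]
    have := h hz hadj
    omega

end ValuedDigraph

namespace AffinePerm

/-- Sets matched by a one-to-one correspondence have equally many elements. -/
theorem ncard_eq_of_rel {α β : Type*} {s : Set α} {t : Set β} (R : α → β → Prop)
    (hs : ∀ x ∈ s, ∃ y ∈ t, R x y) (ht : ∀ y ∈ t, ∃ x ∈ s, R x y)
    (huniq : ∀ x ∈ s, ∀ y ∈ t, ∀ y' ∈ t, R x y → R x y' → y = y')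
    (huniq' : ∀ x ∈ s, ∀ x' ∈ s, ∀ y ∈ t, R x y → R x' y → x = x') : s.ncard = t.ncard := by
  choose f hf hR using hs
  refine Set.ncard_congr f hf ?_ ?_
  · intro x x' hx hx' h
    exact huniq' x hx x' hx' _ (hf x hx) (hR x hx) (h ▸ hR x' hx')
  · intro y hy
    obtain ⟨x, hx, hxy⟩ := ht y hy
    exact ⟨x, hx, huniq x hx _ (hf x hx) _ hy (hR x hx) hxy⟩

variable {n : ℕ} [n.AtLeastTwo]

/-! ### The cylindrical digraph after removal of an inversion set -/

theorem adj_iff {c d : CylDiagram n} {a b : ℤ} (hc : Rep c a b) :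
    (cylDigraph n).graph.Adj c d ↔
      (∃ k, a < k ∧ k < b ∧ Rep d a k) ∨ ∃ k, a < k ∧ k < b ∧ Rep d k b := by
  have hn := n_pos (n := n)
  have h0 : (cylDigraph n).graph.Adj c d ↔ d ∈ cylHook c := by
    refine ⟨fun h => h.2, fun h => ⟨?_, h⟩⟩
    rintro rfl
    exact lt_irrefl _ (cylHook_lt h)
  have h1 : d ∈ cylHook c ↔ (∃ k, c.1.1 < k ∧ k < c.1.2 ∧ Rep d c.1.1 k) ∨
      ∃ k, c.1.1 < k ∧ k < c.1.2 ∧ Rep d k c.1.2 := by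
    refine or_congr ⟨?_, ?_⟩ ⟨?_, ?_⟩
    · rintro ⟨h2, h3, h4⟩
      exact ⟨d.1.2, h3, h4, h2 ▸ rep_self d⟩
    · rintro ⟨k, h2, h3, h4⟩
      have h5 := h4.fst_eq (rep_self c)
      obtain ⟨r, h6, h7⟩ := h4
      exact ⟨h5, by omega, by omega⟩
    · rintro ⟨r, h2, h3, h4⟩
      exact ⟨d.1.1 + r * n, h3, h4, r, rfl, h2.symm⟩
    · rintro ⟨k, h2, h3, r, h4, h5⟩
      have hr : 0 ≤ r := by
        by_contra hr
        have hc := c.2.1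
        have hd := d.2.2.1
        nlinarith
      obtain ⟨s, rfl⟩ := Int.eq_ofNat_of_zero_le hr
      exact ⟨s, by omega, by omega, by omega⟩
  rw [h0, h1]
  obtain ⟨r, rfl, rfl⟩ := hc
  refine or_congr ⟨?_, ?_⟩ ⟨?_, ?_⟩
  · rintro ⟨k, h2, h3, h4⟩
    exact ⟨k + r * n, by omega, by omega, h4.shift r⟩
  · rintro ⟨k, h2, h3, h4⟩
    refine ⟨k + -r * n, by linarith, by linarith, ?_⟩
    have := h4.shift (-r)
    rwa [show c.1.1 + r * n + -r * n = c.1.1 by ring] at this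
  · rintro ⟨k, h2, h3, h4⟩
    exact ⟨k + r * n, by omega, by omega, h4.shift r⟩
  · rintro ⟨k, h2, h3, h4⟩
    refine ⟨k + -r * n, by linarith, by linarith, ?_⟩
    have := h4.shift (-r)
    rwa [show c.1.2 + r * n + -r * n = c.1.2 by ring] at this

theorem adj_of_right {c z : CylDiagram n} {a b d : ℤ} (hc : Rep c a b) (hz : Rep z a d)
    (h : b < d) : (cylDigraph n).graph.Adj z c :=
  (adj_iff hz).mpr (Or.inl ⟨b, hc.lt, h, hc⟩)

theorem adj_of_left {c z : CylDiagram n} {a b e : ℤ} (hc : Rep c a b) (hz : Rep z e b)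
    (h : e < a) : (cylDigraph n).graph.Adj z c :=
  (adj_iff hz).mpr (Or.inr ⟨a, h, hc.lt, hc⟩)

theorem exists_rep_of_adj {c z : CylDiagram n} {a b : ℤ} (hc : Rep c a b)
    (h : (cylDigraph n).graph.Adj z c) : (∃ d, b < d ∧ Rep z a d) ∨ ∃ e < a, Rep z e b := by
  rcases (adj_iff (rep_self z)).mp h with ⟨k, h1, h2, h3⟩ | ⟨k, h1, h2, h3⟩ <;>
  obtain ⟨r, rfl, rfl⟩ := h3.exists_shift hc
  · exact Or.inl ⟨z.1.2 + r * n, by omega, (rep_self z).shift r⟩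
  · exact Or.inr ⟨z.1.1 + r * n, by omega, (rep_self z).shift r⟩

theorem val_eq_ncard (c : CylDiagram n) :
    (cylDigraph n).val c = {k : ℤ | c.1.1 < k ∧ k < c.1.2 ∧ ¬ k ≡ c.1.1 [ZMOD n]}.ncard := by
  refine ncard_eq_of_rel (fun d k => Rep d c.1.1 k) ?_ ?_ ?_ ?_
  · rintro d ⟨h1, h2, h3⟩
    have h4 : Rep d c.1.1 d.1.2 := h1 ▸ rep_self d
    exact ⟨d.1.2, ⟨h2, h3, h4.not_modEq⟩, h4⟩
  · rintro k ⟨h1, h2, h3⟩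
    obtain ⟨d, hd⟩ := exists_rep h1 h3
    have h4 := hd.fst_eq (rep_self c)
    have hd' := hd
    obtain ⟨r, h5, h6⟩ := hd
    exact ⟨d, ⟨h4, by omega, by omega⟩, hd'⟩
  · intro d _ k _ k' _ h h'
    obtain ⟨r, h1, h2⟩ := h.exists_shift h'
    omega
  · intro d _ d' _ k _ h h'
    exact h.unique h'

/-- The core count. When the boxes of `Inv u` have been peeled, the value of a remaining box
`(a, b)` has dropped to the number of `k ≢ a` lying between `a` and `b` both in value and in
position. The remaining `k` correspond to the boxes of `Inv u` in the hook: `k` to the left of `a`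
gives `(a, k)`, and `k` to the right of `b` gives `(k, b)`. If `k = a + t n`, the box `(k, b)` is
the same as `(a, b - t n)`, so that only the `k ≢ a` are needed. -/
theorem ncard_lt_val_iff {u : affinePerm n} {c : CylDiagram n} (hc : c ∉ affineInv u) {a b : ℤ}
    (hrep : Rep c a b) :
    {d | d ∈ affineInv u ∧ (cylDigraph n).graph.Adj c d}.ncard < (cylDigraph n).val c ↔
      ∃ k, a < k ∧ k < b ∧ ¬ k ≡ a [ZMOD n] ∧ pos u a < pos u k ∧ pos u k < pos u b := by
  have main : {d | d ∈ affineInv u ∧ (cylDigraph n).graph.Adj c d}.ncard < (cylDigraph n).val c ↔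
      ∃ k, c.1.1 < k ∧ k < c.1.2 ∧ ¬ k ≡ c.1.1 [ZMOD n] ∧ pos u c.1.1 < pos u k ∧
        pos u k < pos u c.1.2 := by
    have hself := rep_self c
    rw [val_eq_ncard]
    generalize c.1.1 = a at *
    generalize c.1.2 = b at *
    rw [hself.mem_affineInv, not_lt] at hc
    have hlt := hself.lt
    have hab : pos u a < pos u b := lt_of_le_of_ne hc (by rw [Ne, pos_inj]; exact hlt.ne)
    have hKfin : {k : ℤ | a < k ∧ k < b ∧ ¬ k ≡ a [ZMOD n]}.Finite :=
      (Set.finite_Ioo a b).subset fun k hk => ⟨hk.1, hk.2.1⟩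
    have hcount : {d | d ∈ affineInv u ∧ (cylDigraph n).graph.Adj c d}.ncard =
        {k : ℤ | (a < k ∧ k < b ∧ ¬ k ≡ a [ZMOD n]) ∧
          (pos u k < pos u a ∨ pos u b < pos u k)}.ncard := by
      refine ncard_eq_of_rel (fun d k =>
        (pos u k < pos u a ∧ Rep d a k) ∨ (pos u b < pos u k ∧ Rep d k b)) ?_ ?_ ?_ ?_
      · rintro d ⟨hd, hadj⟩
        rcases (adj_iff hself).mp hadj with ⟨k, h1, h2, h3⟩ | ⟨k, h1, h2, h3⟩
        · have h4 := (h3.mem_affineInv u).mp hd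
          exact ⟨k, ⟨⟨h1, h2, h3.not_modEq⟩, Or.inl h4⟩, Or.inl ⟨h4, h3⟩⟩
        · have h4 := (h3.mem_affineInv u).mp hd
          by_cases hk : k ≡ a [ZMOD n]
          · obtain ⟨t, rfl⟩ := modEq_iff_exists.mp hk
            rw [pos_add_mul] at h4
            have h5 : Rep d a (b + -t * n) := by
              have := h3.shift (-t)
              rwa [show a + t * n + -t * n = a by ring] at this
            have h6 : pos u (b + -t * n) < pos u a := by
              rw [pos_add_mul]
              linarith
            exact ⟨b + -t * n, ⟨⟨by linarith, by linarith, h5.not_modEq⟩, Or.inl h6⟩,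
              Or.inl ⟨h6, h5⟩⟩
          · exact ⟨k, ⟨⟨h1, h2, hk⟩, Or.inr h4⟩, Or.inr ⟨h4, h3⟩⟩
      · rintro k ⟨⟨h1, h2, h3⟩, h4⟩
        rcases h4 with h4 | h4
        · obtain ⟨d, hd⟩ := exists_rep h1 h3
          exact ⟨d, ⟨(hd.mem_affineInv u).mpr h4, (adj_iff hself).mpr (Or.inl ⟨k, h1, h2, hd⟩)⟩,
            Or.inl ⟨h4, hd⟩⟩
        · have h5 : ¬ b ≡ k [ZMOD n] := by
            rw [modEq_iff_exists]
            rintro ⟨t, rfl⟩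
            rw [pos_add_mul] at h4
            linarith
          obtain ⟨d, hd⟩ := exists_rep h2 h5
          exact ⟨d, ⟨(hd.mem_affineInv u).mpr h4, (adj_iff hself).mpr (Or.inr ⟨k, h1, h2, hd⟩)⟩,
            Or.inr ⟨h4, hd⟩⟩
      · rintro d - k ⟨⟨-, -, hk⟩, -⟩ k' ⟨⟨-, -, hk'⟩, -⟩ (⟨-, h⟩ | ⟨-, h⟩) (⟨-, h'⟩ | ⟨-, h'⟩) <;>
        obtain ⟨r, h1, h2⟩ := h.exists_shift h'
        · omega
        · exact absurd (modEq_iff_exists.mpr ⟨r, h1⟩) hk'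
        · exact absurd (modEq_iff_exists.mpr ⟨-r, by linarith⟩) hk
        · omega
      · rintro d - d' - k - (⟨h1, h⟩ | ⟨h1, h⟩) (⟨h2, h'⟩ | ⟨h2, h'⟩)
        · exact h.unique h'
        · omega
        · omega
        · exact h.unique h'
    have hsub : {k : ℤ | (a < k ∧ k < b ∧ ¬ k ≡ a [ZMOD n]) ∧
        (pos u k < pos u a ∨ pos u b < pos u k)} ⊆ {k : ℤ | a < k ∧ k < b ∧ ¬ k ≡ a [ZMOD n]} :=
      fun k hk => hk.1
    rw [hcount]
    constructor
    · intro h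
      obtain ⟨k, hk, hk'⟩ := Set.exists_mem_notMem_of_ncard_lt_ncard h (hKfin.subset hsub)
      have h1 : ¬ (pos u k < pos u a ∨ pos u b < pos u k) := fun h => hk' ⟨hk, h⟩
      have h2 : pos u k ≠ pos u a := by
        rw [Ne, pos_inj]
        exact hk.1.ne'
      have h3 : pos u k ≠ pos u b := by
        rw [Ne, pos_inj]
        exact hk.2.1.ne
      exact ⟨k, hk.1, hk.2.1, hk.2.2, by omega, by omega⟩
    · rintro ⟨k, h1, h2, h3, h4, h5⟩
      refine Set.ncard_lt_ncard ⟨hsub, fun h => ?_⟩ hKfin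
      rcases (h ⟨h1, h2, h3⟩).2 with h6 | h6 <;> omega
  rw [main]
  obtain ⟨r, rfl, rfl⟩ := hrep
  have hmod : ∀ k s : ℤ, k + s * n ≡ c.1.1 + s * n [ZMOD n] ↔ k ≡ c.1.1 [ZMOD n] :=
    fun k s => ⟨fun h => Int.ModEq.add_right_cancel' _ h, fun h => h.add_right _⟩
  constructor
  · rintro ⟨k, h1, h2, h3, h4, h5⟩
    refine ⟨k + r * n, by omega, by omega, by rwa [hmod], ?_, ?_⟩ <;>
    · rw [pos_add_mul, pos_add_mul]
      omega
  · rintro ⟨k, h1, h2, h3, h4, h5⟩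
    obtain ⟨k, rfl⟩ : ∃ k', k = k' + r * n := ⟨k - r * n, by ring⟩
    rw [pos_add_mul, pos_add_mul] at h4 h5
    rw [hmod] at h3
    exact ⟨k, by omega, by omega, h3, by omega, by omega⟩

/-- The box `c` may be peeled when exactly the boxes of `Inv u` have been removed. -/
def Peelable (u : affinePerm n) (c : CylDiagram n) : Prop :=
  c ∉ affineInv u ∧
    (cylDigraph n).val c ≤ {d | d ∈ affineInv u ∧ (cylDigraph n).graph.Adj c d}.ncard ∧
    ∀ z, z ∉ affineInv u → (cylDigraph n).graph.Adj z c →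
      {d | d ∈ affineInv u ∧ (cylDigraph n).graph.Adj z d}.ncard < (cylDigraph n).val z

theorem isPeeling_concat_iff {u : affinePerm n} {L : List (CylDiagram n)}
    (hL : {x | x ∈ L} = affineInv u) (c : CylDiagram n) :
    (cylDigraph n).IsPeeling (L ++ [c]) ↔ (cylDigraph n).IsPeeling L ∧ Peelable u c := by
  have hmem : ∀ x, x ∈ L ↔ x ∈ affineInv u := fun x => Set.ext_iff.mp hL x
  rw [ValuedDigraph.isPeeling_concat]
  simp only [hmem, Peelable]
  refine and_congr_right fun _ => ⟨fun h => h.2, fun h => ⟨trivial, h⟩⟩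

/-- An ascent at adjacent positions `p`, `p + 1` may be peeled: nothing lies between these
positions, whereas one of the two entries lies between those of each in-neighbour. -/
theorem peelable_of_ascent {u : affinePerm n} {c : CylDiagram n} {p : ℤ}
    (hc : Rep c (u.1 p) (u.1 (p + 1))) : Peelable u c := by
  have hlt := hc.lt
  have hc' : c ∉ affineInv u := by
    rw [hc.mem_affineInv, pos_apply, pos_apply]
    omega
  refine ⟨hc', ?_, ?_⟩
  · rw [← not_lt, ncard_lt_val_iff hc' hc, pos_apply, pos_apply]
    rintro ⟨k, -, -, -, h4, h5⟩
    omega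
  · intro z hz hadj
    rcases exists_rep_of_adj hc hadj with ⟨d, h1, h2⟩ | ⟨e, h1, h2⟩
    · rw [ncard_lt_val_iff hz h2]
      rw [h2.mem_affineInv, pos_apply] at hz
      have h3 : pos u d ≠ pos u (u.1 p) := by
        rw [Ne, pos_inj]
        omega
      have h4 : pos u d ≠ pos u (u.1 (p + 1)) := by
        rw [Ne, pos_inj]
        omega
      rw [pos_apply] at h3 h4
      refine ⟨u.1 (p + 1), hlt, h1, hc.not_modEq, ?_, ?_⟩
      · rw [pos_apply, pos_apply]
        omega
      · rw [pos_apply]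
        omega
    · rw [ncard_lt_val_iff hz h2]
      rw [h2.mem_affineInv, pos_apply] at hz
      have h3 : pos u e ≠ pos u (u.1 p) := by
        rw [Ne, pos_inj]
        omega
      have h4 : pos u e ≠ pos u (u.1 (p + 1)) := by
        rw [Ne, pos_inj]
        omega
      rw [pos_apply] at h3 h4
      by_cases hmod : u.1 p ≡ e [ZMOD n]
      · -- Here `u p` is a translate of `e`, and a translate of `u (p + 1)` takes its place.
        obtain ⟨t, ht⟩ := modEq_iff_exists.mp hmod
        have h5 : pos u e = p - t * n := by
          have := pos_apply u p
          rw [ht, pos_add_mul] at this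
          omega
        have h6 : 0 < t * n := by omega
        refine ⟨u.1 (p + 1) + -t * n, by linarith, by linarith, ?_, ?_, ?_⟩
        · intro h
          obtain ⟨s, hs⟩ := modEq_iff_exists.mp h
          refine hc.not_modEq (modEq_iff_exists.mpr ⟨s, ?_⟩)
          rw [ht]
          linarith
        · rw [pos_add_mul, pos_apply]
          linarith
        · rw [pos_add_mul, pos_apply]
          linarith
      · refine ⟨u.1 p, h1, hlt, hmod, ?_, ?_⟩
        · rw [pos_apply]
          omega
        · rw [pos_apply, pos_apply]
          omega

/-- Conversely, on the way to `Inv w`, only ascents at adjacent positions may be peeled.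
Let `d` be the first entry `≥ b` after `a`. If `d ≠ b`, then `(a, d)` is an in-neighbour of `(a, b)`
of value `0`, unless `d ≡ a`; in that case `(b, d)` has been inverted, and `w` cannot invert
`(a, b)` as well. If `d = b` and the positions are not adjacent, the entry `e` preceding `b` must be
smaller than `a`, and `(e, b)` is an in-neighbour of `(a, b)` of value `0`. -/
theorem Peelable.exists_ascent {u w : affinePerm n} (huw : affineInv u ⊆ affineInv w)
    {c : CylDiagram n} (hcw : c ∈ affineInv w) (hc : Peelable u c) :
    ∃ p, Rep c (u.1 p) (u.1 (p + 1)) := by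
  obtain ⟨hcu, hval, hin⟩ := hc
  have hself := rep_self c
  rw [← not_lt, ncard_lt_val_iff hcu hself] at hval
  rw [hself.mem_affineInv] at hcu hcw
  generalize c.1.1 = a at *
  generalize c.1.2 = b at *
  have hab := hself.lt
  have hne : pos u a ≠ pos u b := by
    rw [Ne, pos_inj]
    exact hab.ne
  have hfree : ∀ k, a < k → k < b → pos u a < pos u k → pos u k < pos u b → k ≡ a [ZMOD n] := by
    intro k h1 h2 h3 h4
    by_contra h5
    exact hval ⟨k, h1, h2, h5, h3, h4⟩
  obtain ⟨p, ⟨hp1, hp2⟩, hpmin⟩ := Int.exists_least_of_bdd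
    (P := fun p : ℤ => pos u a < p ∧ b ≤ u.1 p) ⟨pos u a, fun p h => h.1.le⟩
    ⟨pos u b, by omega, by simp⟩
  have hpb : p ≤ pos u b := hpmin _ ⟨by omega, by simp⟩
  rcases hp2.lt_or_eq with hlt | heq
  · exfalso
    have hpb' : p < pos u b := by
      refine lt_of_le_of_ne hpb ?_
      rintro rfl
      simp at hlt
    by_cases hmod : u.1 p ≡ a [ZMOD n]
    · obtain ⟨t, ht⟩ := modEq_iff_exists.mp hmod
      have hncong : ¬ u.1 p ≡ b [ZMOD n] :=
        fun h => hself.not_modEq (h.symm.trans hmod)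
      obtain ⟨z, hz⟩ := exists_rep hlt hncong
      have h1 : z ∈ affineInv u := by
        rw [hz.mem_affineInv, pos_apply]
        exact hpb'
      have h2 := (hz.mem_affineInv w).mp (huw h1)
      rw [ht, pos_add_mul] at h2
      omega
    · obtain ⟨z, hz⟩ := exists_rep (hab.trans hlt) hmod
      have hzu : z ∉ affineInv u := by
        rw [hz.mem_affineInv, pos_apply]
        omega
      obtain ⟨k, h1, h2, h3, h4, h5⟩ :=
        (ncard_lt_val_iff hzu hz).mp (hin z hzu (adj_of_right hself hz hlt))
      rw [pos_apply] at h5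
      have hkb : k < b := by
        by_contra hkb
        have := hpmin _ ⟨h4, by rw [apply_pos]; exact not_lt.mp hkb⟩
        omega
      exact h3 (hfree k h1 hkb h4 (by omega))
  · have hp : p = pos u b := by rw [heq, pos_apply]
    by_cases hadj : p = pos u a + 1
    · refine ⟨pos u a, ?_⟩
      rw [← hadj, apply_pos, ← heq]
      exact hself
    exfalso
    have hsucc : u.1 (p - 1 + 1) = b := by
      rw [sub_add_cancel]
      exact heq.symm
    have hncong := not_apply_succ_modEq u (p - 1)
    rw [hsucc] at hncong
    have heb : u.1 (p - 1) < b := by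
      by_contra h
      have := hpmin (p - 1) ⟨by omega, not_lt.mp h⟩
      omega
    have hpe := pos_apply u (p - 1)
    generalize u.1 (p - 1) = e at *
    have hea : e ≠ a := by
      rintro rfl
      omega
    rcases lt_or_gt_of_ne hea with h | h
    · obtain ⟨z, hz⟩ := exists_rep heb hncong
      have hzu : z ∉ affineInv u := by
        rw [hz.mem_affineInv]
        omega
      obtain ⟨k, -, -, -, h4, h5⟩ :=
        (ncard_lt_val_iff hzu hz).mp (hin z hzu (adj_of_left hself hz h))
      omega
    · -- Here `e = a + t n`, and `b - t n` obstructs the peeling of `(a, b)`.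
      obtain ⟨t, rfl⟩ := modEq_iff_exists.mp (hfree e h heb (by omega) (by omega))
      rw [pos_add_mul] at hpe
      have h1 : 0 < t * n := by omega
      have h2 := hfree (b + -t * n) (by linarith) (by linarith)
        (by rw [pos_add_mul]; linarith) (by rw [pos_add_mul]; linarith)
      obtain ⟨s, hs⟩ := modEq_iff_exists.mp h2
      exact hself.not_modEq (modEq_iff_exists.mpr ⟨s + t, by linarith⟩)

/-- A peeling list of `Inv u` extends to one of `Inv w` for every `w` above `u` in the weak
order. -/
theorem exists_isPeeling_append {u w : affinePerm n} (huw : affineInv u ⊆ affineInv w)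
    {L : List (CylDiagram n)} (hL : (cylDigraph n).IsPeeling L) (hLu : {x | x ∈ L} = affineInv u) :
    ∃ M, (cylDigraph n).IsPeeling (L ++ M) ∧ {x | x ∈ L ++ M} = affineInv w := by
  induction hk : (affineInv w \ affineInv u).ncard generalizing u L with
  | zero =>
    rw [Set.ncard_eq_zero (affineInv_finite w).sdiff, Set.sdiff_eq_empty] at hk
    exact ⟨[], by simpa using hL, by simpa [hLu] using huw.antisymm hk⟩
  | succ k ih =>
    have hne : u ≠ w := by
      rintro rfl
      simp at hk
    obtain ⟨p, hp, hpw⟩ := AffinePerm.exists_ascent huw hne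
    obtain ⟨c, hc⟩ := exists_rep hp (not_apply_succ_modEq u p)
    have hins := affineInv_mul_simpleRefl hp hc
    have hcw : c ∈ affineInv w := (hc.mem_affineInv w).mpr hpw
    have hpeel := peelable_of_ascent hc
    have hsub : affineInv (u * simpleRefl n p) ⊆ affineInv w := by
      rw [hins]
      exact Set.insert_subset hcw huw
    have hLc : {x | x ∈ L ++ [c]} = affineInv (u * simpleRefl n p) := by
      rw [hins, ← hLu]
      ext x
      simp [or_comm]
    obtain ⟨M, h1, h2⟩ := ih hsub ((isPeeling_concat_iff hLu c).mpr ⟨hL, hpeel⟩) hLc (by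
      have h3 : affineInv w \ affineInv u =
          insert c (affineInv w \ affineInv (u * simpleRefl n p)) := by
        rw [hins]
        ext x
        simp only [Set.mem_sdiff, Set.mem_insert_iff]
        by_cases hx : x = c
        · subst hx
          simp [hcw, hpeel.1]
        · simp [hx]
      rw [h3, Set.ncard_insert_of_notMem (by rw [hins]; simp) (affineInv_finite w).sdiff] at hk
      omega)
    rw [List.append_assoc] at h1 h2
    exact ⟨_, h1, h2⟩

/-- Peeling lists inside an inversion set consist of inversion sets. -/
theorem exists_affineInv_eq_of_isPeeling {w : affinePerm n} {L : List (CylDiagram n)}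
    (hL : (cylDigraph n).IsPeeling L) (hLw : ∀ x ∈ L, x ∈ affineInv w) :
    ∃ u : affinePerm n, {x | x ∈ L} = affineInv u := by
  induction L using List.reverseRecOn with
  | nil => exact ⟨1, by simp [affineInv_one]⟩
  | append_singleton L c ih =>
    obtain ⟨u, hu⟩ := ih ((ValuedDigraph.isPeeling_append _ L [c]).mp hL).1
      (fun x hx => hLw x (by simp [hx]))
    have hpeel := ((isPeeling_concat_iff hu c).mp hL).2
    have huw : affineInv u ⊆ affineInv w := by
      rw [← hu]
      exact fun x hx => hLw x (by simp [show x ∈ L from hx])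
    obtain ⟨p, hp⟩ := hpeel.exists_ascent huw (hLw c (by simp))
    refine ⟨u * simpleRefl n p, ?_⟩
    rw [affineInv_mul_simpleRefl hp.lt hp, ← hu]
    ext x
    simp [or_comm]

/-! ### Factorizations as chains in the weak order -/

/-- The partial product `v_1 ⋯ v_k`. -/
def partialProd (v : ℕ+ → affinePerm n) (k : ℕ) : affinePerm n :=
  ((List.range k).map fun j => v j.succPNat).prod

@[simp] theorem partialProd_zero (v : ℕ+ → affinePerm n) : partialProd v 0 = 1 := rfl

theorem partialProd_succ (v : ℕ+ → affinePerm n) (k : ℕ) :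
    partialProd v (k + 1) = partialProd v k * v k.succPNat := by
  simp [partialProd, List.range_succ]

theorem partialProd_eq_of_le {v : ℕ+ → affinePerm n} {r : ℕ}
    (hv : ∀ i : ℕ+, r < (i : ℕ) → v i = 1) {k : ℕ} (hk : r ≤ k) :
    partialProd v k = partialProd v r := by
  induction k, hk using Nat.le_induction with
  | base => rfl
  | succ k hk ih =>
    rw [partialProd_succ, hv _ (by rw [Nat.succPNat_coe]; omega), mul_one, ih]

/-- Length-additive factorizations are the ascending chains of the weak order. -/
theorem isCycDecFactorization_iff (w : affinePerm n) (v : ℕ+ → affinePerm n) :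
    IsCycDecFactorization w v ↔ (∀ i, IsCycDec (v i)) ∧
      (∀ k, affineInv (partialProd v k) ⊆ affineInv (partialProd v (k + 1))) ∧
      ∃ r : ℕ, (∀ i : ℕ+, r < (i : ℕ) → v i = 1) ∧ w = partialProd v r := by
  refine and_congr_right fun _ => ?_
  have hstep : ∀ k, (affineInv (partialProd v k) ⊆ affineInv (partialProd v (k + 1)) ↔
      affineLength (partialProd v (k + 1)) =
        affineLength (partialProd v k) + affineLength (v k.succPNat)) := by
    intro k
    rw [partialProd_succ, ← ncard_affineInv_mul_eq_iff, affineLength_eq_ncard,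
      affineLength_eq_ncard, affineLength_eq_ncard]
  have hle : ∀ k, affineLength (partialProd v (k + 1)) ≤
      affineLength (partialProd v k) + affineLength (v k.succPNat) := by
    intro k
    rw [partialProd_succ, affineLength_eq_ncard, affineLength_eq_ncard, affineLength_eq_ncard]
    exact ncard_affineInv_mul_le _ _
  have hone : affineLength (partialProd v 0) = 0 := by
    rw [affineLength_eq_ncard, partialProd_zero, affineInv_one, Set.ncard_empty]
  constructor
  · rintro ⟨r, hr, rfl, hlen⟩
    refine ⟨fun k => ?_, r, hr, rfl⟩
    by_cases hk : k < r
    · rw [hstep]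
      -- A strict inequality at step `k` would persist up to step `r`.
      refine le_antisymm (hle k) ?_
      by_contra hlt
      have hsum : ∀ j, affineLength (partialProd v j) ≤
          ∑ i ∈ Finset.range j, affineLength (v i.succPNat) := by
        intro j
        induction j with
        | zero => rw [hone]; simp
        | succ j ih =>
          rw [Finset.sum_range_succ]
          have := hle j
          omega
      have hstrict : ∀ j, k + 1 ≤ j → affineLength (partialProd v j) <
          ∑ i ∈ Finset.range j, affineLength (v i.succPNat) := by
        intro j hj
        induction j, hj using Nat.le_induction with
        | base =>
          rw [Finset.sum_range_succ]
          have := hsum k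
          omega
        | succ j hj ih =>
          rw [Finset.sum_range_succ]
          have := hle j
          omega
      exact (hstrict r hk).ne hlen
    · rw [partialProd_eq_of_le hr (not_lt.mp hk),
        partialProd_eq_of_le hr (show r ≤ k + 1 by omega)]
  · rintro ⟨hchain, r, hr, rfl⟩
    refine ⟨r, hr, rfl, ?_⟩
    have : ∀ k, affineLength (partialProd v k) =
        ∑ i ∈ Finset.range k, affineLength (v i.succPNat) := by
      intro k
      induction k with
      | zero => rw [hone]; simp
      | succ k ih => rw [(hstep k).mp (hchain k), ih, Finset.sum_range_succ]
    exact this r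

/-! ### Factorizations and semistandard functions -/

/-- The factorization `v` and the function `f` on `Inv w` correspond to each other: the boxes of
value at most `k` are the inversions of `v_1 ⋯ v_k`. -/
def Corresponds (w : affinePerm n) (v : ℕ+ → affinePerm n) (f : affineInv w → ℕ+) : Prop :=
  ∀ k c, c ∈ affineInv (partialProd v k) ↔ ∃ h : c ∈ affineInv w, (f ⟨c, h⟩ : ℕ) ≤ k

theorem Corresponds.ext_left {w : affinePerm n} {v v' : ℕ+ → affinePerm n} {f : affineInv w → ℕ+}
    (h : Corresponds w v f) (h' : Corresponds w v' f) : v = v' := by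
  have hU : ∀ k, partialProd v k = partialProd v' k := fun k =>
    affineInv_injective (Set.ext fun c => (h k c).trans (h' k c).symm)
  funext i
  obtain ⟨k, rfl⟩ : ∃ k : ℕ, i = k.succPNat := ⟨i.natPred, by simp⟩
  have h1 := hU (k + 1)
  rwa [partialProd_succ, partialProd_succ, hU k, mul_right_inj] at h1

theorem Corresponds.ext_right {w : affinePerm n} {v : ℕ+ → affinePerm n} {f f' : affineInv w → ℕ+}
    (h : Corresponds w v f) (h' : Corresponds w v f') : f = f' := by
  have key : ∀ {f f' : affineInv w → ℕ+}, Corresponds w v f → Corresponds w v f' →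
      ∀ c, (f c : ℕ) ≤ f' c := by
    intro f f' h h' c
    obtain ⟨_, h1⟩ := (h _ _).mp ((h' (f' c) c).mpr ⟨c.2, le_rfl⟩)
    exact h1
  funext c
  exact PNat.coe_injective (le_antisymm (key h h' c) (key h' h c))

/-- Corresponding factorizations and functions have the same monomial. -/
theorem Corresponds.card_fiber {w : affinePerm n} {v : ℕ+ → affinePerm n} {f : affineInv w → ℕ+}
    (h : Corresponds w v f)
    (hchain : ∀ k, affineInv (partialProd v k) ⊆ affineInv (partialProd v (k + 1))) (i : ℕ+) :
    Nat.card {z // f z = i} = affineLength (v i) := by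
  obtain ⟨k, rfl⟩ : ∃ k : ℕ, i = k.succPNat := ⟨i.natPred, by simp⟩
  have h1 : Nat.card {z // f z = k.succPNat} =
      (affineInv (partialProd v (k + 1)) \ affineInv (partialProd v k)).ncard := by
    have himg : affineInv (partialProd v (k + 1)) \ affineInv (partialProd v k) =
        Subtype.val '' {z | f z = k.succPNat} := by
      ext c
      rw [Set.mem_sdiff, h, h, Set.mem_image]
      constructor
      · rintro ⟨⟨hc, h2⟩, h3⟩
        refine ⟨⟨c, hc⟩, PNat.coe_injective ?_, rfl⟩
        have h4 : ¬ (f ⟨c, hc⟩ : ℕ) ≤ k := fun h4 => h3 ⟨hc, h4⟩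
        rw [Nat.succPNat_coe]
        omega
      · rintro ⟨z, hz, rfl⟩
        have h4 : (f z : ℕ) = k + 1 := by rw [show f z = _ from hz]; rfl
        exact ⟨⟨z.2, h4.le⟩, fun ⟨_, h5⟩ => by
          have h6 : (f z : ℕ) ≤ k := h5
          omega⟩
    rw [himg, Set.ncard_image_of_injective _ Subtype.val_injective]
    rfl
  have h2 := Set.ncard_sdiff_add_ncard_of_subset (hchain k) (affineInv_finite _)
  have h3 := hchain k
  rw [partialProd_succ, ← ncard_affineInv_mul_eq_iff] at h3
  rw [h1, affineLength_eq_ncard]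
  rw [partialProd_succ] at h2 ⊢
  omega

theorem partialProd_mono {v : ℕ+ → affinePerm n}
    (hchain : ∀ k, affineInv (partialProd v k) ⊆ affineInv (partialProd v (k + 1))) :
    Monotone fun k => affineInv (partialProd v k) :=
  monotone_nat_of_le_succ hchain

/-- Concatenating peeling lists of the successive factors shows that the function attached to a
factorization is semistandard. -/
theorem exists_mem_SSF {w : affinePerm n} {v : ℕ+ → affinePerm n}
    (hv : IsCycDecFactorization w v) :
    ∃ f ∈ (cylDigraph n).SSF (affineInv w) (cylColumns n), Corresponds w v f := by
  classical
  obtain ⟨hcyc, hchain, r, hr, rfl⟩ := (isCycDecFactorization_iff w v).mp hv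
  have hmono := partialProd_mono hchain
  have hex : ∀ c : affineInv (partialProd v r), ∃ k, (c : CylDiagram n) ∈
      affineInv (partialProd v k) := fun c => ⟨r, c.2⟩
  have hpos : ∀ c, 0 < Nat.find (hex c) := by
    intro c
    rw [Nat.find_pos, partialProd_zero, affineInv_one]
    exact Set.notMem_empty _
  let f : affineInv (partialProd v r) → ℕ+ := fun c => ⟨Nat.find (hex c), hpos c⟩
  have hle : ∀ k, affineInv (partialProd v k) ⊆ affineInv (partialProd v r) := by
    intro k
    rcases le_total k r with h | h
    · exact hmono h
    · rw [partialProd_eq_of_le hr h]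
  have hf : Corresponds (partialProd v r) v f := by
    intro k c
    constructor
    · intro hc
      exact ⟨hle k hc, Nat.find_min' _ hc⟩
    · rintro ⟨hc, h⟩
      exact hmono h (Nat.find_spec (hex ⟨c, hc⟩))
  refine ⟨f, ?_, hf⟩
  have hlists : ∀ k, ∃ L : List (affineInv (partialProd v r)),
      (cylDigraph n).IsPeeling (L.map Subtype.val) ∧
      {x | x ∈ L.map Subtype.val} = affineInv (partialProd v k) ∧
      L.Pairwise fun z w => f z ≤ f w ∧ ((w : CylDiagram n) ∈ cylColumns n z → f z < f w) := by
    intro k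
    induction k with
    | zero => exact ⟨[], trivial, by simp [affineInv_one], List.Pairwise.nil⟩
    | succ k ih =>
      obtain ⟨L, h1, h2, h3⟩ := ih
      obtain ⟨M, h4, h5⟩ := exists_isPeeling_append (hchain k) h1 h2
      have hM : ∀ x ∈ M, x ∈ affineInv (partialProd v r) := by
        intro x hx
        refine hle (k + 1) ?_
        rw [← h5]
        simp [hx]
      obtain ⟨N, rfl⟩ : ∃ N : List (affineInv (partialProd v r)), N.map Subtype.val = M :=
        ⟨M.attach.map fun x => ⟨x.1, hM x.1 x.2⟩, by simp [List.map_map, Function.comp_def]⟩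
      rw [← List.map_append] at h4 h5
      have hnd : (L ++ N).Nodup := List.Nodup.of_map _ h4.nodup
      rw [List.nodup_append'] at hnd
      have hLval : ∀ x ∈ L, (f x : ℕ) ≤ k := by
        intro x hx
        have h6 : (x : CylDiagram n) ∈ affineInv (partialProd v k) := by
          rw [← h2]
          exact List.mem_map_of_mem hx
        obtain ⟨_, h7⟩ := (hf k x).mp h6
        exact h7
      have hNmem : ∀ x ∈ N, (x : CylDiagram n) ∈
          affineInv (partialProd v (k + 1)) \ affineInv (partialProd v k) := by
        intro x hx
        refine ⟨?_, ?_⟩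
        · rw [← h5]
          exact List.mem_map_of_mem (List.mem_append_right _ hx)
        · rw [← h2]
          intro h6
          obtain ⟨y, hy, hyx⟩ := List.mem_map.mp h6
          rw [Subtype.val_injective hyx] at hy
          exact hnd.2.2 hy hx
      have hNval : ∀ x ∈ N, (f x : ℕ) = k + 1 := by
        intro x hx
        obtain ⟨h6, h7⟩ := hNmem x hx
        obtain ⟨_, h8⟩ := (hf _ x).mp h6
        have h9 : ¬ (f x : ℕ) ≤ k := fun h9 => h7 ((hf k x).mpr ⟨x.2, h9⟩)
        have h10 : (f x : ℕ) ≤ k + 1 := h8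
        omega
      refine ⟨L ++ N, h4, h5, ?_⟩
      rw [List.pairwise_append]
      refine ⟨h3, ?_, ?_⟩
      · have hcol : ColDistinct
            (affineInv (partialProd v (k + 1)) \ affineInv (partialProd v k)) := by
          have h6 := hchain k
          rw [partialProd_succ] at h6 ⊢
          exact (colDistinct_sdiff_iff h6).mpr (hcyc _)
        refine List.Pairwise.imp_of_mem ?_ hnd.2.1
        intro x y hx hy hxy
        refine ⟨?_, fun h => absurd ?_ hxy⟩
        · rw [← PNat.coe_le_coe, hNval x hx, hNval y hy]
        · exact Subtype.val_injective (hcol x (hNmem x hx) y (hNmem y hy) h)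
      · intro x hx y hy
        have h6 : f x < f y := by
          rw [← PNat.coe_lt_coe, hNval y hy]
          have := hLval x hx
          omega
        exact ⟨h6.le, fun _ => h6⟩
  obtain ⟨L, h1, h2, h3⟩ := hlists r
  exact ⟨L, ⟨h1, h2⟩, h3⟩

/-- A list along which `f` increases begins with its entries of value at most `k`. -/
theorem exists_split_of_pairwise {α : Type*} (f : α → ℕ) (k : ℕ) {L : List α}
    (hL : L.Pairwise fun x y => f x ≤ f y) :
    ∃ M N, L = M ++ N ∧ (∀ x ∈ M, f x ≤ k) ∧ ∀ x ∈ N, k < f x := by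
  induction L with
  | nil => exact ⟨[], [], by simp⟩
  | cons x L ih =>
    rw [List.pairwise_cons] at hL
    by_cases hx : f x ≤ k
    · obtain ⟨M, N, rfl, h1, h2⟩ := ih hL.2
      refine ⟨x :: M, N, rfl, ?_, h2⟩
      simpa using ⟨hx, h1⟩
    · refine ⟨[], x :: L, rfl, by simp, ?_⟩
      intro y hy
      rcases List.mem_cons.mp hy with rfl | hy
      · omega
      · have := hL.1 y hy
        omega

/-- The boxes of value at most `k` of a semistandard function form a prefix of a peeling list, hence
an inversion set; the quotients of the successive elements are the factors. -/
theorem exists_isCycDecFactorization {w : affinePerm n} {f : affineInv w → ℕ+}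
    (hf : f ∈ (cylDigraph n).SSF (affineInv w) (cylColumns n)) :
    ∃ v, IsCycDecFactorization w v ∧ Corresponds w v f := by
  obtain ⟨L, ⟨hpeel, hL⟩, hpair⟩ := hf
  have hmemL : ∀ x : affineInv w, x ∈ L := by
    intro x
    have h : (x : CylDiagram n) ∈ {x | x ∈ L.map Subtype.val} := by
      rw [hL]
      exact x.2
    obtain ⟨y, hy, hyx⟩ := List.mem_map.mp h
    rwa [← Subtype.val_injective hyx]
  have hex : ∀ k : ℕ, ∃ u : affinePerm n, ∀ c,
      c ∈ affineInv u ↔ ∃ h : c ∈ affineInv w, (f ⟨c, h⟩ : ℕ) ≤ k := by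
    intro k
    obtain ⟨M, N, rfl, h1, h2⟩ := exists_split_of_pairwise (fun x => (f x : ℕ)) k
      (hpair.imp fun h => h.1)
    rw [List.map_append, ValuedDigraph.isPeeling_append] at hpeel
    obtain ⟨u, hu⟩ := exists_affineInv_eq_of_isPeeling (w := w) hpeel.1 (by
      intro x hx
      obtain ⟨y, -, rfl⟩ := List.mem_map.mp hx
      exact y.2)
    refine ⟨u, fun c => ?_⟩
    rw [← hu]
    constructor
    · intro hc
      obtain ⟨y, hy, rfl⟩ := List.mem_map.mp hc
      exact ⟨y.2, h1 y hy⟩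
    · rintro ⟨hc, hle⟩
      rcases List.mem_append.mp (hmemL ⟨c, hc⟩) with h | h
      · exact List.mem_map.mpr ⟨_, h, rfl⟩
      · have := h2 _ h
        omega
  choose u hu using hex
  let v : ℕ+ → affinePerm n := fun i => (u i.natPred)⁻¹ * u i
  have hu0 : u 0 = 1 := by
    refine affineInv_injective ?_
    rw [affineInv_one]
    refine Set.eq_empty_of_forall_notMem fun c hc => ?_
    obtain ⟨h, h1⟩ := (hu 0 c).mp hc
    have := (f ⟨c, h⟩).pos
    omega
  have hv : ∀ k : ℕ, v k.succPNat = (u k)⁻¹ * u (k + 1) := fun k => by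
    simp [v]
  have hprod : ∀ k, partialProd v k = u k := by
    intro k
    induction k with
    | zero => rw [hu0, partialProd_zero]
    | succ k ih => rw [partialProd_succ, ih, hv, mul_inv_cancel_left]
  have hcorr : Corresponds w v f := fun k c => by rw [hprod]; exact hu k c
  have hchain : ∀ k, affineInv (partialProd v k) ⊆ affineInv (partialProd v (k + 1)) := by
    intro k c hc
    obtain ⟨h, h1⟩ := (hcorr k c).mp hc
    exact (hcorr (k + 1) c).mpr ⟨h, by omega⟩
  refine ⟨v, (isCycDecFactorization_iff w v).mpr ⟨?_, hchain, ?_⟩, hcorr⟩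
  · intro i
    obtain ⟨k, rfl⟩ : ∃ k : ℕ, i = k.succPNat := ⟨i.natPred, by simp⟩
    have h1 := hchain k
    rw [partialProd_succ] at h1
    rw [← colDistinct_sdiff_iff h1, ← partialProd_succ]
    have hval : ∀ c ∈ affineInv (partialProd v (k + 1)) \ affineInv (partialProd v k),
        ∃ h : c ∈ affineInv w, (f ⟨c, h⟩ : ℕ) = k + 1 := by
      rintro c ⟨h2, h3⟩
      obtain ⟨h, h4⟩ := (hcorr _ c).mp h2
      have h5 : ¬ (f ⟨c, h⟩ : ℕ) ≤ k := fun h5 => h3 ((hcorr k c).mpr ⟨h, h5⟩)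
      exact ⟨h, by omega⟩
    intro c hc d hd hcd
    obtain ⟨hcw, hfc⟩ := hval c hc
    obtain ⟨hdw, hfd⟩ := hval d hd
    by_contra hne
    let S : affineInv w → affineInv w → Prop := fun x y => f x < f y ∨ f y < f x ∨ y.1.1.1 ≠ x.1.1.1
    have hS : L.Pairwise S := hpair.imp fun {x y} h => by
      by_cases hxy : y.1.1.1 = x.1.1.1
      · exact Or.inl (h.2 hxy)
      · exact Or.inr (Or.inr hxy)
    have hsymm : Std.Symm S := ⟨fun x y h => by
      rcases h with h | h | h
      · exact Or.inr (Or.inl h)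
      · exact Or.inl h
      · exact Or.inr (Or.inr h.symm)⟩
    have h7 : S ⟨c, hcw⟩ ⟨d, hdw⟩ :=
      hS.forall (hmemL _) (hmemL _) fun h => hne (congrArg Subtype.val h)
    simp only [S] at h7
    rw [← PNat.coe_lt_coe, ← PNat.coe_lt_coe, hfc, hfd] at h7
    rcases h7 with h7 | h7 | h7
    · omega
    · omega
    · exact h7 hcd
  · obtain ⟨r, hr⟩ : ∃ r : ℕ, ∀ c, (f c : ℕ) ≤ r := by
      have : Finite (affineInv w) := affineInv_finite w
      obtain ⟨r, hr⟩ := (Set.finite_range fun c => (f c : ℕ)).bddAbove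
      exact ⟨r, fun c => hr ⟨c, rfl⟩⟩
    have hlarge : ∀ k, r ≤ k → u k = w := by
      intro k hk
      refine affineInv_injective (Set.ext fun c => ?_)
      rw [hu]
      exact ⟨fun ⟨h, _⟩ => h, fun h => ⟨h, (hr _).trans hk⟩⟩
    refine ⟨r, ?_, ?_⟩
    · intro i hi
      obtain ⟨k, rfl⟩ : ∃ k : ℕ, i = k.succPNat := ⟨i.natPred, by simp⟩
      rw [Nat.succPNat_coe] at hi
      rw [hv, hlarge k (by omega), hlarge (k + 1) (by omega), inv_mul_cancel]
    · rw [hprod, hlarge r le_rfl]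

end AffinePerm

theorem mainTheorem5 (n : ℕ) [n.AtLeastTwo] (ω : affinePerm n) :
    affineInv ω ∈ (cylDigraph n).IS ∧
      affineStanley ω = (cylDigraph n).Gam (affineInv ω) (cylColumns n) := by
  constructor
  · obtain ⟨M, h1, h2⟩ := AffinePerm.exists_isPeeling_append (u := 1) (w := ω) (L := [])
      (by simp [AffinePerm.affineInv_one]) trivial (by simp [AffinePerm.affineInv_one])
    exact ⟨M, h1, h2⟩
  · funext m
    show ((cycDecFactorizations ω m).ncard : ℤ) =
      (((cylDigraph n).SSFOfContent (affineInv ω) (cylColumns n) m).ncard : ℤ)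
    congr 1
    refine AffinePerm.ncard_eq_of_rel (AffinePerm.Corresponds ω) ?_ ?_ ?_ ?_
    · rintro v ⟨hv, hm⟩
      obtain ⟨f, hf, hvf⟩ := AffinePerm.exists_mem_SSF hv
      have hchain := ((AffinePerm.isCycDecFactorization_iff ω v).mp hv).2.1
      exact ⟨f, ⟨hf, fun i => (hvf.card_fiber hchain i).trans (hm i)⟩, hvf⟩
    · rintro f ⟨hf, hm⟩
      obtain ⟨v, hv, hvf⟩ := AffinePerm.exists_isCycDecFactorization hf
      have hchain := ((AffinePerm.isCycDecFactorization_iff ω v).mp hv).2.1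
      exact ⟨v, ⟨hv, fun i => (hvf.card_fiber hchain i).symm.trans (hm i)⟩, hvf⟩
    · exact fun v _ f _ f' _ h h' => h.ext_right h'
    · exact fun v _ v' _ f _ h h' => h.ext_left h'
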